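/- Let $\beta$ be a formal parameter, let $x=(x_1,x_2,\dots)$ be infinitely many variables, let $p_n=\sum_i x_i^n$ be the power sums, and put $\overline{x}=\frac{-x}{1+\beta x}$. Let $\widehat{\Lambda}_\sharp$ be the space of all formal sums $\sum_{\lambda} c_\lambda\, p_{\lambda_1}p_{\lambda_2}\cdots p_{\lambda_{\ell(\lambda)}}$ over all partitions $\lambda$, with arbitrary coefficients $c_\lambda\in\mathbb{Q}(\beta)$, regarded as formal power series in $x$. Let $$G\Gamma_\sharp=\{f\in\widehat{\Lambda}_\sharp \mid f(t,\overline{t},x_3,x_4,\dots)\text{ is independent of } t\}.$$ For $n\ge 1$ define $$p_n^{(\beta)}(x)=p_n\!\left(\tfrac{x_1}{1+\frac{\beta}{2}x_1},\tfrac{x_2}{1+\frac{\beta}{2}x_2},\dots\right),\qquad \sum_{n\ge 0} q_n^{(\beta)}(x)\,z^n=\prod_i\frac{1-\overline{x_i}\,z}{1-x_i z},\qquad \overline{q}_n^{(\beta)}(x)=q_n^{(\beta)}(\overline{x_1},\overline{x_2},\dots),$$ and for a partition $\lambda$ put $p^{(\beta)}_\lambda=\prod_j p^{(\beta)}_{\lambda_j}$,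 $q^{(\beta)}_\lambda=\prod_j q^{(\beta)}_{\lambda_j}$, $\overline{q}^{(\beta)}_\lambda=\prod_j \overline{q}^{(\beta)}_{\lambda_j}$ (each equal to $1$ for the empty partition). Let $\mathcal{OP}$ be the set of partitions all of whose parts are odd and $\mathcal{SP}$ the set of partitions with pairwise distinct parts. **Theorem.** For each of the five families $$\mathrm{(i)}\ \{p_\lambda^{(\beta)}\}_{\lambda\in\mathcal{OP}},\quad \mathrm{(ii)}\ \{q_\lambda^{(\beta)}\}_{\lambda\in\mathcal{OP}},\quad \mathrm{(iii)}\ \{\overline{q}_\lambda^{(\beta)}\}_{\lambda\in\mathcal{OP}},\quad \mathrm{(iv)}\ \{q_\lambda^{(\beta)}\}_{\lambda\in\mathcal{SP}},\quad \mathrm{(v)}\ \{\overline{q}_\lambda^{(\beta)}\}_{\lambda\in\mathcal{SP}},$$ every $f\in G\Gamma_\sharp$ can be expressed in exactly one way as an infinite $\mathbb{Q}(\beta)$-linear combination $f=\sum_\lambda c_\lambda u_\lambda$ of the members $u_\lambda$ of that family. Here the infinite sum is formal: for every monomial in $x$, only finitely many terms $c_\lambda u_\lambda$ have a nonzero coefficient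 at it, and these coefficients add up to that of $f$. -/

import Mathlib

noncomputable section

namespace KQ

/-- The base field `ℚ(β)` of rational functions in the formal parameter `β`. -/
abbrev K : Type := RatFunc ℚ

/-- The formal parameter `β`. -/
def β : K := RatFunc.X

/-- Formal power series over `ℚ(β)` in infinitely many variables `x₁, x₂, …`;
the variable `x_{i+1}` is `MvPowerSeries.X i`. -/
abbrev Series : Type := MvPowerSeries ℕ K

/-- All partitions: `λ.1 = |λ|` and `λ.2.parts` is the multiset of (positive) parts. -/
abbrev Partitions : Type := Σ n : ℕ, n.Partition

/-- The odd partitions: every part is odd. -/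
def OP : Set Partitions := {lam | ∀ i ∈ lam.2.parts, Odd i}

/-- The strict partitions: the parts are pairwise distinct. -/
def SP : Set Partitions := {lam | lam.2.parts.Nodup}

/-- For a family `u₁, u₂, …` and a partition `λ`, the product `u_{λ₁} u_{λ₂} ⋯`. -/
def partProd (u : ℕ → Series) (lam : Partitions) : Series := (lam.2.parts.map u).prod

/-- `f` is the formal infinite linear combination `∑ᵢ cᵢ bᵢ`: only finitely many terms contribute
to the coefficient of any given monomial, and these contributions add up to the coefficient
of `f`. -/
def IsFormalSum {ι : Type*} (c : ι → K) (b : ι → Series) (f : Series) : Prop :=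
  ∀ d : ℕ →₀ ℕ, (Function.support fun i => c i * MvPowerSeries.coeff d (b i)).Finite ∧
    MvPowerSeries.coeff d f = ∑ᶠ i, c i * MvPowerSeries.coeff d (b i)

open Classical in
/-- The power sum `pₙ = x₁ⁿ + x₂ⁿ + ⋯` (used for `n ≥ 1` only). -/
def psum (n : ℕ) : Series := fun d => if ∃ i : ℕ, d = Finsupp.single i n then 1 else 0

theorem isFormalSum_psum {n : ℕ} (hn : 0 < n) :
    IsFormalSum (fun _ : ℕ => 1) (fun i => (MvPowerSeries.X i : Series) ^ n) (psum n) := by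
  classical
  intro d
  have key : ∀ i : ℕ, (1 : K) * MvPowerSeries.coeff d ((MvPowerSeries.X i : Series) ^ n)
      = if d = Finsupp.single i n then 1 else 0 := by
    intro i
    rw [one_mul, MvPowerSeries.coeff_X_pow]
  simp only [key]
  by_cases h : ∃ i : ℕ, d = Finsupp.single i n
  · obtain ⟨i, rfl⟩ := h
    have hj : ∀ j : ℕ, (Finsupp.single i n = Finsupp.single j n) ↔ j = i := by
      intro j
      rw [Finsupp.single_left_inj hn.ne']
      exact eq_comm
    simp only [hj]
    refine ⟨(Set.finite_singleton i).subset ?_, ?_⟩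
    · intro j hj'
      by_contra hne
      exact hj' (if_neg hne)
    · rw [finsum_eq_single _ i (fun j hne => if_neg hne), if_pos rfl]
      exact if_pos ⟨i, rfl⟩
  · have hz : (fun i : ℕ => if d = Finsupp.single i n then (1 : K) else 0) = fun _ => 0 := by
      funext i
      exact if_neg fun hi => h ⟨i, hi⟩
    rw [hz]
    refine ⟨by simp, ?_⟩
    rw [finsum_zero]
    exact if_neg h

/-- The space `Λ̂_♯` of formal sums `∑_λ c_λ p_{λ₁} p_{λ₂} ⋯` over all partitions,
with arbitrary coefficients in `ℚ(β)`. -/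
def LambdaSharp : Set Series := {f | ∃ c : Partitions → K, IsFormalSum c (partProd psum) f}

/-- `x̄ = -x / (1 + β x)`, the inverse of `x` for `x ⊕ y = x + y + β x y`, for a power series `x`
without constant term. -/
def bar {σ : Type*} (x : MvPowerSeries σ K) : MvPowerSeries σ K :=
  -x * (1 + MvPowerSeries.C β * x)⁻¹

/-- The substitution `(x₁, x₂, x₃, x₄, …) ↦ (t, t̄, x₃, x₄, …)`. The target variables are
`t = X none` and `x_{i+3} = X (some i)`. -/
def cancelVars : ℕ → MvPowerSeries (Option ℕ) K
  | 0 => MvPowerSeries.X none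
  | 1 => bar (MvPowerSeries.X none)
  | i + 2 => MvPowerSeries.X (some i)

/-- The `K`-`Q`-cancellation property: `f(t, t̄, x₃, x₄, …)` is independent of `t`, that is, no
monomial that contains `t` occurs in it. -/
def KQCancellation (f : Series) : Prop :=
  ∀ d : Option ℕ →₀ ℕ, d none ≠ 0 →
    MvPowerSeries.coeff d (MvPowerSeries.subst cancelVars f) = 0

/-- The algebra `GΓ_♯`. -/
def GGammaSharp : Set Series := {f | f ∈ LambdaSharp ∧ KQCancellation f}

/-- `xᵢ / (1 + (β/2) xᵢ)`. -/
def halfVars (i : ℕ) : Series :=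
  MvPowerSeries.X i * (1 + MvPowerSeries.C (β / 2) * MvPowerSeries.X i)⁻¹

/-- `x̄ᵢ`. -/
def barVars (i : ℕ) : Series := bar (MvPowerSeries.X i)

theorem hasSubst_halfVars : MvPowerSeries.HasSubst halfVars :=
  MvPowerSeries.HasSubst.X.mul_right _

theorem hasSubst_barVars : MvPowerSeries.HasSubst barVars := by
  have h : barVars = fun i => (MvPowerSeries.X i : Series) *
      -(1 + MvPowerSeries.C β * MvPowerSeries.X i)⁻¹ := by
    funext i
    simp [barVars, bar]
  rw [h]
  exact MvPowerSeries.HasSubst.X.mul_right _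

theorem hasSubst_cancelVars : MvPowerSeries.HasSubst cancelVars := by
  classical
  refine ⟨fun s => ?_, fun d => ?_⟩
  · match s with
    | 0 => simp [cancelVars]
    | 1 => simp [cancelVars, bar]
    | i + 2 => simp [cancelVars]
  · have hfin : Set.Finite {i : ℕ | d = Finsupp.single (some i) 1} := by
      refine Set.Subsingleton.finite fun i hi j hj => ?_
      have hij := hi.symm.trans hj
      rw [Finsupp.single_left_inj one_ne_zero] at hij
      exact Option.some.inj hij
    refine (((Set.finite_singleton 0).union (Set.finite_singleton 1)).union
      (hfin.image (· + 2))).subset ?_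
    intro s hs
    match s with
    | 0 => exact Or.inl (Or.inl rfl)
    | 1 => exact Or.inl (Or.inr rfl)
    | i + 2 =>
      refine Or.inr ⟨i, ?_, rfl⟩
      by_contra hne
      refine hs ?_
      simp only [cancelVars]
      rw [MvPowerSeries.coeff_X]
      exact if_neg hne

/-- The `β`-deformed power sum `pₙ^{(β)}(x) = pₙ(x / (1 + (β/2) x))`. -/
def pBeta (n : ℕ) : Series := MvPowerSeries.subst halfVars (psum n)

/-- The factor `(1 - x̄ᵢ z) / (1 - xᵢ z)`, a power series in `z` over the power series in `x`. -/
def qFactor (i : ℕ) : PowerSeries Series :=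
  (1 - PowerSeries.C (barVars i) * PowerSeries.X) *
    PowerSeries.invOfUnit (1 - PowerSeries.C (MvPowerSeries.X i) * PowerSeries.X) 1

/-- The `β`-deformed `q`-function `qₙ^{(β)}`: the coefficient of `zⁿ` in the infinite product
`∏ᵢ (1 - x̄ᵢ z) / (1 - xᵢ z)`. The factors with index outside the support of a monomial `d` do
not affect its coefficient, see `coeff_qBeta`. -/
def qBeta (n : ℕ) : Series := fun d =>
  MvPowerSeries.coeff d (PowerSeries.coeff n (∏ i ∈ Finset.range (d.support.sup id + 1), qFactor i))

theorem qFactor_sub_one (i : ℕ) :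
    ∃ g : PowerSeries Series, qFactor i = 1 + PowerSeries.C (MvPowerSeries.X i) * g := by
  have hinv := PowerSeries.mul_invOfUnit
    (1 - PowerSeries.C (MvPowerSeries.X i : Series) * PowerSeries.X) 1 (by simp)
  set w := PowerSeries.invOfUnit
    (1 - PowerSeries.C (MvPowerSeries.X i : Series) * PowerSeries.X) 1 with hw
  refine ⟨PowerSeries.C (1 + (1 + MvPowerSeries.C β * MvPowerSeries.X i)⁻¹) *
    PowerSeries.X * w, ?_⟩
  have hb : barVars i = -(MvPowerSeries.X i *
      (1 + MvPowerSeries.C β * (MvPowerSeries.X i : Series))⁻¹) := by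
    simp [barVars, bar]
  rw [qFactor, ← hw, hb]
  simp only [map_neg, map_mul, map_add, map_one]
  linear_combination hinv

/-- The coefficients of the partial products `∏_{i < N}` stabilise, to those of `qₙ^{(β)}`. -/
theorem coeff_qBeta (n : ℕ) (d : ℕ →₀ ℕ) (N : ℕ) (hN : d.support.sup id + 1 ≤ N) :
    MvPowerSeries.coeff d (PowerSeries.coeff n (∏ i ∈ Finset.range N, qFactor i)) =
      MvPowerSeries.coeff d (qBeta n) := by
  induction N, hN using Nat.le_induction with
  | base => rfl
  | succ N hN ih =>
    rw [← ih, Finset.prod_range_succ]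
    obtain ⟨g, hg⟩ := qFactor_sub_one N
    have hd : d N = 0 := by
      by_contra h
      have h1 : N ≤ d.support.sup id :=
        Finset.le_sup (f := id) (Finsupp.mem_support_iff.mpr h)
      omega
    have hz := (MvPowerSeries.X_dvd_iff (R := K)).mp
      (Dvd.intro (PowerSeries.coeff n ((∏ i ∈ Finset.range N, qFactor i) * g)) rfl) d hd
    rw [hg, mul_add, mul_one, map_add, map_add, mul_left_comm, PowerSeries.coeff_C_mul, hz,
      add_zero]

/-- `q̄ₙ^{(β)}(x) = qₙ^{(β)}(x̄)`. -/
def qBarBeta (n : ℕ) : Series := MvPowerSeries.subst barVars (qBeta n)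

/-- `f` has a unique expression as an infinite `ℚ(β)`-linear combination of the functions
`u_λ = u_{λ₁} u_{λ₂} ⋯` indexed by the partitions `λ` in `S`. -/
def UniquelyExpands (S : Set Partitions) (u : ℕ → Series) (f : Series) : Prop :=
  ∃! c : S → K, IsFormalSum c (fun lam : S => partProd u lam) f

end KQ

end

/-!
Everything is reduced to the classical algebra of Schur's `Q`-functions by passing to lowest
degree terms.

An element of `GΓ_♯` is symmetric and satisfies `f(t, t̄, x₃, …) = f(0, 0, x₃, …)`; the series with
these two properties form an algebra `gammaHat`. Since `t̄ = -t + ⋯`, the homogeneous component of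
lowest degree `n` of such a series lies in `gammaHom n`, the symmetric forms of degree `n` with
`g(t, -t, x₃, …) = g(0, 0, x₃, …)` (`LeadingForm.mem_gammaHom`). The members of the five families
belong to `gammaHat`: `x / (1 + (β/2) x)` changes sign under `x ↦ x̄`, and the factors of
`∏ᵢ (1 - x̄ᵢ z) / (1 - xᵢ z)` at `t` and `t̄` cancel. The infinite sums and products are handled as
coefficientwise limits over finite sets of variables (`CoeffLimit`). Their leading forms are
products of the power sums `pₖ` and, up to sign, of the coefficients `Qₖ` (`qLead`) of
`Q(z) = ∏ᵢ (1 + xᵢ z) / (1 - xᵢ z)`.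

It then suffices that these leading forms constitute a basis of `gammaHom n`, because coefficients
can be determined degree by degree (`existsUnique_isFormalSum`). Extracting the coefficient of
`t^{2k}` from the cancellation property expresses the coefficient of `g` at a monomial with a
repeated exponent `k` by coefficients at monomials with a larger sum of squares of exponents. So `g`
is determined by its coefficients at monomials with distinct exponents, and `dim (gammaHom n)` is at
most the number of strict partitions of `n` (`finrank_gammaHom_le`). That is also the number of odd
partitions of `n`, by Euler's theorem, and the products of odd power sums are linearly independent,
hence a basis. The relations `Q(z) Q(-z) = 1` and `z Q'(z) = 2 Q(z) ∑ pₖ zᵏ` (`k` odd) show that the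
products of the `Qₖ` with odd indices span as well. The first of them has the same shape as the
relation between coefficients above, and the same straightening argument (`straighten`) shows that
the products with distinct indices span. Spanning families of the right cardinality are bases.
-/

noncomputable section

namespace KQ

open Filter MvPowerSeries

/-! ### Leading forms -/

section LeadingForm

variable {σ τ R : Type*} [CommRing R]

/-- `f` has no terms of degree less than `n`, and its homogeneous component of degree `n` is `g`.
The component `g` is allowed to vanish. -/
structure LeadingForm (n : ℕ) (f g : MvPowerSeries σ R) : Prop where
  coeff_of_lt : ∀ d, d.degree < n → coeff d f = 0
  coeff_of_eq : ∀ d, d.degree = n → coeff d f = coeff d g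
  coeff_of_ne : ∀ d, d.degree ≠ n → coeff d g = 0

theorem LeadingForm.unique {n : ℕ} {f g g' : MvPowerSeries σ R} (h : LeadingForm n f g)
    (h' : LeadingForm n f g') : g = g' := by
  ext d
  by_cases hd : d.degree = n
  · rw [← h.coeff_of_eq d hd, h'.coeff_of_eq d hd]
  · rw [h.coeff_of_ne d hd, h'.coeff_of_ne d hd]

theorem LeadingForm.one : LeadingForm 0 (1 : MvPowerSeries σ R) 1 where
  coeff_of_lt d hd := by omega
  coeff_of_eq d _ := rfl
  coeff_of_ne d hd := by
    classical
    rw [coeff_one, if_neg]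
    rintro rfl
    simp at hd

theorem LeadingForm.zero (n : ℕ) : LeadingForm n (0 : MvPowerSeries σ R) 0 where
  coeff_of_lt d _ := by simp
  coeff_of_eq d _ := rfl
  coeff_of_ne d _ := by simp

theorem LeadingForm.X (i : σ) : LeadingForm 1 (X i : MvPowerSeries σ R) (X i) := by
  classical
  have h : ∀ d : σ →₀ ℕ, d.degree ≠ 1 → coeff d (MvPowerSeries.X i : MvPowerSeries σ R) = 0 := by
    intro d hd
    rw [coeff_X, if_neg]
    rintro rfl
    simp at hd
  exact ⟨fun d hd => h d hd.ne, fun d _ => rfl, h⟩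

theorem LeadingForm.add {n : ℕ} {f g f' g' : MvPowerSeries σ R} (h : LeadingForm n f g)
    (h' : LeadingForm n f' g') : LeadingForm n (f + f') (g + g') where
  coeff_of_lt d hd := by simp [h.coeff_of_lt d hd, h'.coeff_of_lt d hd]
  coeff_of_eq d hd := by simp [h.coeff_of_eq d hd, h'.coeff_of_eq d hd]
  coeff_of_ne d hd := by simp [h.coeff_of_ne d hd, h'.coeff_of_ne d hd]

theorem LeadingForm.neg {n : ℕ} {f g : MvPowerSeries σ R} (h : LeadingForm n f g) :
    LeadingForm n (-f) (-g) where
  coeff_of_lt d hd := by simp [h.coeff_of_lt d hd]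
  coeff_of_eq d hd := by simp [h.coeff_of_eq d hd]
  coeff_of_ne d hd := by simp [h.coeff_of_ne d hd]

theorem LeadingForm.sum {ι : Type*} {n : ℕ} (s : Finset ι) {f g : ι → MvPowerSeries σ R}
    (h : ∀ i ∈ s, LeadingForm n (f i) (g i)) :
    LeadingForm n (∑ i ∈ s, f i) (∑ i ∈ s, g i) where
  coeff_of_lt d hd := by
    rw [map_sum]
    exact Finset.sum_eq_zero fun i hi => (h i hi).coeff_of_lt d hd
  coeff_of_eq d hd := by
    rw [map_sum, map_sum]
    exact Finset.sum_congr rfl fun i hi => (h i hi).coeff_of_eq d hd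
  coeff_of_ne d hd := by
    rw [map_sum]
    exact Finset.sum_eq_zero fun i hi => (h i hi).coeff_of_ne d hd

theorem LeadingForm.mul {m n : ℕ} {f g f' g' : MvPowerSeries σ R} (h : LeadingForm m f g)
    (h' : LeadingForm n f' g') : LeadingForm (m + n) (f * f') (g * g') := by
  classical
  have hdeg : ∀ {d : σ →₀ ℕ} {p : (σ →₀ ℕ) × (σ →₀ ℕ)}, p ∈ Finset.HasAntidiagonal.antidiagonal d →
      p.1.degree + p.2.degree = d.degree := by
    intro d p hp
    rw [← Finset.HasAntidiagonal.mem_antidiagonal.mp hp, map_add]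
  refine ⟨fun d hd => ?_, fun d hd => ?_, fun d hd => ?_⟩
  · rw [coeff_mul]
    refine Finset.sum_eq_zero fun p hp => ?_
    have := hdeg hp
    rcases lt_or_ge p.1.degree m with h1 | h1
    · rw [h.coeff_of_lt _ h1, zero_mul]
    · rw [h'.coeff_of_lt p.2 (by omega), mul_zero]
  · rw [coeff_mul, coeff_mul]
    refine Finset.sum_congr rfl fun p hp => ?_
    have := hdeg hp
    rcases lt_trichotomy p.1.degree m with h1 | h1 | h1
    · rw [h.coeff_of_lt _ h1, h.coeff_of_ne _ h1.ne, zero_mul, zero_mul]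
    · rw [h.coeff_of_eq _ h1, h'.coeff_of_eq p.2 (by omega)]
    · rw [h'.coeff_of_lt p.2 (by omega), h'.coeff_of_ne p.2 (by omega), mul_zero, mul_zero]
  · rw [coeff_mul]
    refine Finset.sum_eq_zero fun p hp => ?_
    have := hdeg hp
    by_cases h1 : p.1.degree = m
    · rw [h'.coeff_of_ne p.2 (by omega), mul_zero]
    · rw [h.coeff_of_ne _ h1, zero_mul]

theorem LeadingForm.pow {m : ℕ} {f g : MvPowerSeries σ R} (h : LeadingForm m f g) (k : ℕ) :
    LeadingForm (k * m) (f ^ k) (g ^ k) := by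
  induction k with
  | zero => simpa using LeadingForm.one
  | succ k ih => simpa [pow_succ, add_mul] using ih.mul h

theorem LeadingForm.finsetProd {ι : Type*} (s : Finset ι) {e : ι → ℕ}
    {f g : ι → MvPowerSeries σ R} (h : ∀ i ∈ s, LeadingForm (e i) (f i) (g i)) :
    LeadingForm (∑ i ∈ s, e i) (∏ i ∈ s, f i) (∏ i ∈ s, g i) := by
  classical
  induction s using Finset.induction_on with
  | empty => simpa using LeadingForm.one
  | insert i s hi ih =>
    rw [Finset.sum_insert hi, Finset.prod_insert hi, Finset.prod_insert hi]
    exact (h i (by simp)).mul (ih fun j hj => h j (by simp [hj]))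

theorem LeadingForm.multisetProd {f g : ℕ → MvPowerSeries σ R} (s : Multiset ℕ)
    (h : ∀ k ∈ s, LeadingForm k (f k) (g k)) :
    LeadingForm s.sum (s.map f).prod (s.map g).prod := by
  induction s using Multiset.induction_on with
  | empty => simpa using LeadingForm.one
  | cons k s ih =>
    simp only [Multiset.sum_cons, Multiset.map_cons, Multiset.prod_cons]
    exact (h k (by simp)).mul (ih fun j hj => h j (by simp [hj]))

/-- The leading form of a series of order at least `n`: its homogeneous component. -/
theorem LeadingForm.exists_of_order {n : ℕ} {f : MvPowerSeries σ R}
    (h : ∀ d, d.degree < n → coeff d f = 0) : ∃ g, LeadingForm n f g := by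
  classical
  refine ⟨fun d => if d.degree = n then coeff d f else 0, h, fun d hd => ?_, fun d hd => ?_⟩
  · exact (if_pos hd).symm
  · exact if_neg hd

/-- Substituting series without constant term commutes with taking leading forms: the leading
form of `f(a)` is that of `f`, evaluated at the linear parts of `a`. -/
theorem LeadingForm.subst {n : ℕ} {f g : MvPowerSeries σ R} (h : LeadingForm n f g)
    {a b : σ → MvPowerSeries τ R} (ha : HasSubst a) (hb : HasSubst b)
    (hab : ∀ i, LeadingForm 1 (a i) (b i)) :
    LeadingForm n (subst a f) (subst b g) := by
  have key : ∀ e : σ →₀ ℕ, LeadingForm e.degree (e.prod fun s k => a s ^ k)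
      (e.prod fun s k => b s ^ k) := fun e => by
    have := LeadingForm.finsetProd e.support (fun i _ => (hab i).pow (e i))
    simpa [Finsupp.degree_apply, Finsupp.prod] using this
  refine ⟨fun d hd => ?_, fun d hd => ?_, fun d hd => ?_⟩
  · rw [coeff_subst ha, finsum_eq_zero_of_forall_eq_zero]
    intro e
    rcases lt_or_ge e.degree n with he | he
    · rw [h.coeff_of_lt e he, zero_smul]
    · rw [(key e).coeff_of_lt d (by omega), smul_zero]
  · rw [coeff_subst ha, coeff_subst hb]
    refine finsum_congr fun e => ?_
    rcases lt_trichotomy e.degree n with he | he | he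
    · rw [h.coeff_of_lt e he, h.coeff_of_ne e he.ne, zero_smul, zero_smul]
    · rw [h.coeff_of_eq e he, (key e).coeff_of_eq d (by omega)]
    · rw [(key e).coeff_of_lt d (by omega), h.coeff_of_ne e he.ne', smul_zero, zero_smul]
  · rw [coeff_subst hb, finsum_eq_zero_of_forall_eq_zero]
    intro e
    by_cases he : e.degree = n
    · rw [(key e).coeff_of_ne d (by omega), smul_zero]
    · rw [h.coeff_of_ne e he, zero_smul]

end LeadingForm

/-! ### Coefficientwise limits over finite sets of variables -/

section Limit

variable {σ τ R : Type*} [CommRing R]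

/-- The net `F`, indexed by the finite sets of (indices of) variables, converges coefficientwise
to `f`: each coefficient is eventually constant. -/
def CoeffLimit (F : Finset ℕ → MvPowerSeries σ R) (f : MvPowerSeries σ R) : Prop :=
  ∀ d, ∀ᶠ S in atTop, coeff d (F S) = coeff d f

theorem CoeffLimit.unique {F G : Finset ℕ → MvPowerSeries σ R} {f g : MvPowerSeries σ R}
    (hf : CoeffLimit F f) (hg : CoeffLimit G g) (h : ∀ᶠ S in atTop, F S = G S) : f = g := by
  ext d
  obtain ⟨S, h1, h2, h3⟩ := ((hf d).and ((hg d).and h)).exists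
  rw [← h1, h3, h2]

theorem CoeffLimit.const (f : MvPowerSeries σ R) : CoeffLimit (fun _ => f) f :=
  fun _ => Eventually.of_forall fun _ => rfl

theorem CoeffLimit.smul {F : Finset ℕ → MvPowerSeries σ R} {f : MvPowerSeries σ R}
    (hf : CoeffLimit F f) (r : R) : CoeffLimit (fun S => r • F S) (r • f) := fun d => by
  filter_upwards [hf d] with S h
  simp [h]

theorem CoeffLimit.sum {ι : Type*} (s : Finset ι) {F : ι → Finset ℕ → MvPowerSeries σ R}
    {f : ι → MvPowerSeries σ R} (h : ∀ i ∈ s, CoeffLimit (F i) (f i)) :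
    CoeffLimit (fun S => ∑ i ∈ s, F i S) (∑ i ∈ s, f i) := fun d => by
  filter_upwards [(eventually_all_finset s).mpr fun i hi => h i hi d] with S hS
  rw [map_sum, map_sum]
  exact Finset.sum_congr rfl hS

theorem CoeffLimit.mul {F G : Finset ℕ → MvPowerSeries σ R} {f g : MvPowerSeries σ R}
    (hf : CoeffLimit F f) (hg : CoeffLimit G g) :
    CoeffLimit (fun S => F S * G S) (f * g) := fun d => by
  classical
  filter_upwards [(eventually_all_finset (Finset.HasAntidiagonal.antidiagonal d)).mpr fun p _ =>
    (hf p.1).and (hg p.2)] with S hS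
  rw [coeff_mul, coeff_mul]
  exact Finset.sum_congr rfl fun p hp => by rw [(hS p hp).1, (hS p hp).2]

/-- A substitution is continuous: each coefficient of `f(a)` depends on finitely many coefficients
of `f`. -/
theorem CoeffLimit.subst {F : Finset ℕ → MvPowerSeries σ R} {f : MvPowerSeries σ R}
    (hf : CoeffLimit F f) {a : σ → MvPowerSeries τ R} (ha : HasSubst a) :
    CoeffLimit (fun S => subst a (F S)) (subst a f) := fun d => by
  -- The series with all coefficients `1` shows that only finitely many monomials matter.
  have hfin := coeff_subst_finite ha (fun _ => 1 : MvPowerSeries σ R) d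
  have hone : ∀ e : σ →₀ ℕ, coeff e (fun _ => 1 : MvPowerSeries σ R) = 1 := fun _ => rfl
  simp only [hone, one_smul] at hfin
  have hfin' : (Function.support fun e : σ →₀ ℕ =>
    coeff d (e.prod fun s k => a s ^ k)).Finite := hfin
  filter_upwards [(eventually_all_finset hfin'.toFinset).mpr fun e _ => hf e] with S hS
  rw [coeff_subst ha, coeff_subst ha]
  refine finsum_congr fun e => ?_
  by_cases he : coeff d (e.prod fun s k => a s ^ k) = 0
  · rw [he, smul_zero, smul_zero]
  · rw [hS e (by simpa using he)]

theorem CoeffLimit.perm {F : Finset ℕ → MvPowerSeries σ R} {f : MvPowerSeries σ R}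
    (hf : CoeffLimit F f) (π : Equiv.Perm ℕ) :
    CoeffLimit (fun S => F (S.map π.toEmbedding)) f := fun d => by
  have ht : Tendsto (fun S : Finset ℕ => S.map π.toEmbedding) atTop atTop := by
    refine tendsto_atTop.mpr fun T => ?_
    filter_upwards [eventually_ge_atTop (T.map π.symm.toEmbedding)] with S hS
    intro i hi
    rw [Finset.mem_map_equiv]
    exact hS (Finset.mem_map_of_mem _ hi)
  exact ht.eventually (hf d)

/-- Two substitutions that agree on the members of a convergent net agree on its limit. -/
theorem CoeffLimit.subst_eq_subst {F : Finset ℕ → MvPowerSeries σ R} {f : MvPowerSeries σ R}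
    (hf : CoeffLimit F f) {a b : σ → MvPowerSeries τ R} (ha : HasSubst a) (hb : HasSubst b)
    (h : ∀ᶠ S in atTop, MvPowerSeries.subst a (F S) = MvPowerSeries.subst b (F S)) :
    MvPowerSeries.subst a f = MvPowerSeries.subst b f :=
  (hf.subst ha).unique (hf.subst hb) h

end Limit

/-! ### The completed algebra of symmetric series with cancellation -/

/-- The permuted variables `x_{π 1}, x_{π 2}, …`. -/
def permVars (π : Equiv.Perm ℕ) (i : ℕ) : Series := X (π i)

theorem hasSubst_permVars (π : Equiv.Perm ℕ) : HasSubst (permVars π) :=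
  HasSubst.X_comp (π : ℕ → ℕ)

theorem coeff_subst_permVars (π : Equiv.Perm ℕ) (f : Series) (d : ℕ →₀ ℕ) :
    coeff (d.mapDomain π) (subst (permVars π) f) = coeff d f := by
  have h := coeff_embDomain_rename π.toEmbedding f d
  rw [Finsupp.embDomain_eq_mapDomain, rename_eq_subst] at h
  exact h

/-- The substitution `(x₁, x₂, x₃, …) ↦ (0, 0, x₃, …)`, that is, `cancelVars` at `t = 0`. -/
def cancelZero : ℕ → MvPowerSeries (Option ℕ) K
  | 0 => 0
  | 1 => 0
  | i + 2 => X (some i)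

/-- The substitution `(x₁, x₂, x₃, …) ↦ (t, -t, x₃, …)`, the linear part of `cancelVars`. -/
def cancelLin : ℕ → MvPowerSeries (Option ℕ) K
  | 0 => X none
  | 1 => -X none
  | i + 2 => X (some i)

theorem hasSubst_of_X_some {a : ℕ → MvPowerSeries (Option ℕ) K} (h0 : constantCoeff (a 0) = 0)
    (h1 : constantCoeff (a 1) = 0) (h2 : ∀ i, a (i + 2) = X (some i)) : HasSubst a := by
  classical
  refine ⟨fun s => ?_, fun d => ?_⟩
  · match s with
    | 0 => simp [h0]
    | 1 => simp [h1]
    | i + 2 => simp [h2]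
  · have hfin : Set.Finite {i : ℕ | d = Finsupp.single (some i) 1} := by
      refine Set.Subsingleton.finite fun i hi j hj => ?_
      have hij := hi.symm.trans hj
      rw [Finsupp.single_left_inj one_ne_zero] at hij
      exact Option.some.inj hij
    refine (((Set.finite_singleton 0).union (Set.finite_singleton 1)).union
      (hfin.image (· + 2))).subset ?_
    intro s hs
    match s with
    | 0 => exact Or.inl (Or.inl rfl)
    | 1 => exact Or.inl (Or.inr rfl)
    | i + 2 =>
      refine Or.inr ⟨i, ?_, rfl⟩
      by_contra hne
      refine hs ?_
      rw [h2, coeff_X]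
      exact if_neg hne

theorem hasSubst_cancelZero : HasSubst cancelZero :=
  hasSubst_of_X_some (by simp [cancelZero]) (by simp [cancelZero]) fun _ => rfl

theorem hasSubst_cancelLin : HasSubst cancelLin :=
  hasSubst_of_X_some (by simp [cancelLin]) (by simp [cancelLin]) fun _ => rfl

/-- The algebra of symmetric power series `f` with `f(t, t̄, x₃, …) = f(0, 0, x₃, …)`. It contains
`GΓ_♯`, and is presented as an intersection of equalizers of substitutions, so that its closure
properties are evident. -/
def gammaHat : Subalgebra K Series :=
  (⨅ π : Equiv.Perm ℕ, AlgHom.equalizer (substAlgHom (hasSubst_permVars π)) (AlgHom.id K Series)) ⊓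
    AlgHom.equalizer (substAlgHom hasSubst_cancelVars) (substAlgHom hasSubst_cancelZero)

theorem mem_gammaHat {f : Series} : f ∈ gammaHat ↔
    (∀ π, subst (permVars π) f = f) ∧ subst cancelVars f = subst cancelZero f := by
  simp [gammaHat, Algebra.mem_inf, Algebra.mem_iInf, AlgHom.mem_equalizer]

/-- The symmetric series `g`, homogeneous of degree `n`, with `g(t, -t, x₃, …) = g(0, 0, x₃, …)`:
the degree `n` part of the algebra generated by Schur's `Q`-functions. -/
def gammaHom (n : ℕ) : Submodule K Series where
  carrier := {g | (∀ d, d.degree ≠ n → coeff d g = 0) ∧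
    (∀ π, subst (permVars π) g = g) ∧ subst cancelLin g = subst cancelZero g}
  zero_mem' := by
    refine ⟨fun d _ => by simp, fun π => ?_, ?_⟩
    · rw [← coe_substAlgHom (hasSubst_permVars π), map_zero]
    · rw [← coe_substAlgHom hasSubst_cancelLin, ← coe_substAlgHom hasSubst_cancelZero, map_zero,
        map_zero]
  add_mem' := by
    rintro f g ⟨hf, hf', hf''⟩ ⟨hg, hg', hg''⟩
    refine ⟨fun d hd => by simp [hf d hd, hg d hd], fun π => ?_, ?_⟩
    · rw [subst_add (hasSubst_permVars π), hf', hg']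
    · rw [subst_add hasSubst_cancelLin, subst_add hasSubst_cancelZero, hf'', hg'']
  smul_mem' := by
    rintro c f ⟨hf, hf', hf''⟩
    refine ⟨fun d hd => by simp [hf d hd], fun π => ?_, ?_⟩
    · rw [subst_smul (hasSubst_permVars π), hf']
    · rw [subst_smul hasSubst_cancelLin, subst_smul hasSubst_cancelZero, hf'']

/-! ### The series `x̄` and `x / (1 + (β/2) x)` -/

theorem constantCoeff_eq_zero_of_hasSubst {σ τ : Type*} {a : σ → MvPowerSeries τ K}
    (ha : HasSubst a) (i : σ) : constantCoeff (a i) = 0 :=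
  (ha.const_coeff i).eq_zero

theorem constantCoeff_subst_of_hasSubst {σ τ : Type*} {a : σ → MvPowerSeries τ K}
    (ha : HasSubst a) {x : MvPowerSeries σ K} (hx : constantCoeff x = 0) :
    constantCoeff (subst a x) = 0 :=
  constantCoeff_subst_eq_zero ha (constantCoeff_eq_zero_of_hasSubst ha) hx

theorem one_add_C_mul_mul_inv {σ : Type*} {x : MvPowerSeries σ K} (hx : constantCoeff x = 0)
    (b : K) : (1 + C b * x) * (1 + C b * x)⁻¹ = 1 :=
  MvPowerSeries.mul_inv_cancel _ (by simp [hx])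

theorem subst_one_add_C_mul_inv {σ τ : Type*} {a : σ → MvPowerSeries τ K} (ha : HasSubst a)
    {x : MvPowerSeries σ K} (hx : constantCoeff x = 0) (b : K) :
    subst a (1 + C b * x)⁻¹ = (1 + C b * subst a x)⁻¹ := by
  have h1 := congrArg (subst a) (one_add_C_mul_mul_inv hx b)
  have h2 := one_add_C_mul_mul_inv (constantCoeff_subst_of_hasSubst ha hx) b
  rw [subst_mul ha, subst_add ha, subst_mul ha, subst_C,
    show subst a (1 : MvPowerSeries σ K) = 1 by rw [← coe_substAlgHom ha, map_one]] at h1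
  calc subst a (1 + C b * x)⁻¹
      = ((1 + C b * subst a x) * subst a (1 + C b * x)⁻¹) * (1 + C b * subst a x)⁻¹ := by
        linear_combination -(subst a (1 + C b * x)⁻¹) * h2
    _ = _ := by rw [h1, one_mul]

/-- `x / (1 + (β/2) x)`. -/
def half {σ : Type*} (x : MvPowerSeries σ K) : MvPowerSeries σ K :=
  x * (1 + C (β / 2) * x)⁻¹

theorem subst_bar {σ τ : Type*} {a : σ → MvPowerSeries τ K} (ha : HasSubst a)
    {x : MvPowerSeries σ K} (hx : constantCoeff x = 0) : subst a (bar x) = bar (subst a x) := by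
  rw [bar, bar, subst_mul ha, subst_one_add_C_mul_inv ha hx, ← coe_substAlgHom ha, map_neg]

theorem subst_half {σ τ : Type*} {a : σ → MvPowerSeries τ K} (ha : HasSubst a)
    {x : MvPowerSeries σ K} (hx : constantCoeff x = 0) : subst a (half x) = half (subst a x) := by
  rw [half, half, subst_mul ha, subst_one_add_C_mul_inv ha hx]

theorem constantCoeff_bar {σ : Type*} {x : MvPowerSeries σ K} (hx : constantCoeff x = 0) :
    constantCoeff (bar x) = 0 := by
  simp [bar, hx]

theorem bar_mul {σ : Type*} {x : MvPowerSeries σ K} (hx : constantCoeff x = 0) :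
    bar x * (1 + C β * x) = -x := by
  rw [bar]
  linear_combination -x * one_add_C_mul_mul_inv hx β

theorem bar_bar {σ : Type*} {x : MvPowerSeries σ K} (hx : constantCoeff x = 0) :
    bar (bar x) = x := by
  have h1 := bar_mul hx
  have h2 := bar_mul (constantCoeff_bar hx)
  -- `(1 + β x̄)(1 + β x) = 1`
  have h3 : (1 + C β * bar x) * (1 + C β * x) = 1 := by linear_combination C β * h1
  linear_combination (1 + C β * x) * h2 - bar (bar x) * h3 - h1

/-- In the coordinate `x / (1 + (β/2) x)`, the involution `x ↦ x̄` is a change of sign. -/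
theorem half_bar {σ : Type*} {x : MvPowerSeries σ K} (hx : constantCoeff x = 0) :
    half (bar x) = -half x := by
  have h1 := bar_mul hx
  have h2 := one_add_C_mul_mul_inv hx (β / 2)
  have h3 := one_add_C_mul_mul_inv (constantCoeff_bar hx) (β / 2)
  have hb : (C β : MvPowerSeries σ K) = C (β / 2) + C (β / 2) := by rw [← map_add, add_halves]
  rw [half, half]
  set b : MvPowerSeries σ K := C (β / 2)
  set u := (1 + b * x)⁻¹
  set v := (1 + b * bar x)⁻¹
  rw [hb] at h1
  -- cross-multiplied, the claim reads `x̄ (1 + b x) = -x (1 + b x̄)` with `b = β / 2`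
  have h4 : bar x * (1 + b * x) = -x * (1 + b * bar x) := by linear_combination h1
  linear_combination u * v * h4 - bar x * v * h2 - x * u * h3

theorem bar_zero {σ : Type*} : bar (0 : MvPowerSeries σ K) = 0 := by simp [bar]

theorem half_zero {σ : Type*} : half (0 : MvPowerSeries σ K) = 0 := by simp [half]

theorem LeadingForm.inv_one_add {σ : Type*} {x : MvPowerSeries σ K} (hx : constantCoeff x = 0)
    (b : K) : LeadingForm 0 (1 + C b * x)⁻¹ 1 := by
  classical
  refine ⟨fun d hd => by omega, fun d hd => ?_, LeadingForm.one.coeff_of_ne⟩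
  obtain rfl : d = 0 := (Finsupp.degree_eq_zero_iff d).mp hd
  simp [MvPowerSeries.constantCoeff_inv, hx]

theorem LeadingForm.bar {σ : Type*} {x y : MvPowerSeries σ K} (h : LeadingForm 1 x y) :
    LeadingForm 1 (bar x) (-y) := by
  have hx : constantCoeff x = 0 := by simpa using h.coeff_of_lt 0 (by simp)
  have := h.neg.mul (LeadingForm.inv_one_add hx β)
  rwa [mul_one] at this

theorem LeadingForm.half {σ : Type*} {x y : MvPowerSeries σ K} (h : LeadingForm 1 x y) :
    LeadingForm 1 (half x) y := by
  have hx : constantCoeff x = 0 := by simpa using h.coeff_of_lt 0 (by simp)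
  have := h.mul (LeadingForm.inv_one_add hx (β / 2))
  rwa [mul_one] at this

/-! ### Membership in the algebra and leading forms -/

theorem leadingForm_cancelVars : ∀ i, LeadingForm 1 (cancelVars i) (cancelLin i)
  | 0 => LeadingForm.X _
  | 1 => (LeadingForm.X _).bar
  | _ + 2 => LeadingForm.X _

theorem leadingForm_cancelZero : ∀ i, LeadingForm 1 (cancelZero i) (cancelZero i)
  | 0 => LeadingForm.zero _
  | 1 => LeadingForm.zero _
  | _ + 2 => LeadingForm.X _

/-- Leading forms of symmetric series with the `K`-theoretic cancellation property have the
classical cancellation property. -/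
theorem LeadingForm.mem_gammaHom {n : ℕ} {f g : Series} (h : LeadingForm n f g)
    (hf : f ∈ gammaHat) : g ∈ gammaHom n := by
  obtain ⟨h1, h2⟩ := mem_gammaHat.mp hf
  refine ⟨h.coeff_of_ne, fun π => ?_, ?_⟩
  · have := h.subst (hasSubst_permVars π) (hasSubst_permVars π) fun i => LeadingForm.X (π i)
    rw [h1] at this
    exact this.unique h
  · have h3 := h.subst hasSubst_cancelVars hasSubst_cancelLin leadingForm_cancelVars
    rw [h2] at h3
    exact h3.unique (h.subst hasSubst_cancelZero hasSubst_cancelZero leadingForm_cancelZero)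

/-- A limit of series in finitely many of the variables belongs to `gammaHat` if these are permuted
among each other by permutations of the variables and satisfy the cancellation property as soon as
they involve `x₁` and `x₂`. -/
theorem CoeffLimit.mem_gammaHat {F : Finset ℕ → Series} {f : Series} (hf : CoeffLimit F f)
    (hperm : ∀ π S, MvPowerSeries.subst (permVars π) (F S) = F (S.map π.toEmbedding))
    (hcancel : ∀ S, {0, 1} ⊆ S →
      MvPowerSeries.subst cancelVars (F S) = MvPowerSeries.subst cancelZero (F S)) :
    f ∈ gammaHat := by
  refine KQ.mem_gammaHat.mpr ⟨fun π => ?_, ?_⟩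
  · exact (hf.subst (hasSubst_permVars π)).unique (hf.perm π) (Eventually.of_forall (hperm π))
  · refine hf.subst_eq_subst hasSubst_cancelVars hasSubst_cancelZero ?_
    filter_upwards [eventually_ge_atTop ({0, 1} : Finset ℕ)] with S hS using hcancel S hS

@[to_additive]
theorem prod_eq_prod_of_pair {M : Type*} [CommMonoid M] {S : Finset ℕ} (hS : {0, 1} ⊆ S)
    {a b : ℕ → M} (h : a 0 * a 1 = b 0 * b 1) (h2 : ∀ i, a (i + 2) = b (i + 2)) :
    ∏ i ∈ S, a i = ∏ i ∈ S, b i := by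
  rw [← Finset.prod_sdiff hS, ← Finset.prod_sdiff (f := b) hS, Finset.prod_pair zero_ne_one,
    Finset.prod_pair zero_ne_one, h]
  congr 1
  refine Finset.prod_congr rfl fun i hi => ?_
  match i, hi with
  | 0, hi => simp at hi
  | 1, hi => simp at hi
  | i + 2, _ => exact h2 i

theorem coeffLimit_psum {n : ℕ} (hn : 0 < n) :
    CoeffLimit (fun S => ∑ i ∈ S, (X i : Series) ^ n) (psum n) := by
  classical
  intro d
  obtain ⟨hfin, hsum⟩ := isFormalSum_psum hn d
  filter_upwards [eventually_ge_atTop hfin.toFinset] with S hS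
  rw [hsum, map_sum, finsum_eq_sum_of_support_subset _ (by simpa using hS)]
  simp

theorem subst_permVars_sum (π : Equiv.Perm ℕ) (S : Finset ℕ) (w : ℕ → Series)
    (hw : ∀ i, subst (permVars π) (w i) = w (π i)) :
    subst (permVars π) (∑ i ∈ S, w i) = ∑ i ∈ S.map π.toEmbedding, w i := by
  rw [Finset.sum_map, ← coe_substAlgHom (hasSubst_permVars π), map_sum]
  exact Finset.sum_congr rfl fun i _ => by rw [coe_substAlgHom, hw]; rfl

theorem subst_permVars_psum {n : ℕ} (hn : 0 < n) (π : Equiv.Perm ℕ) :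
    subst (permVars π) (psum n) = psum n := by
  refine ((coeffLimit_psum hn).subst (hasSubst_permVars π)).unique ((coeffLimit_psum hn).perm π)
    (Eventually.of_forall fun S => subst_permVars_sum _ _ _ fun i => ?_)
  rw [subst_pow (hasSubst_permVars π), subst_X (hasSubst_permVars π), permVars]

theorem subst_permVars_partProd_psum (lam : Partitions) (π : Equiv.Perm ℕ) :
    subst (permVars π) (partProd psum lam) = partProd psum lam := by
  rw [partProd, ← coe_substAlgHom (hasSubst_permVars π), map_multiset_prod, Multiset.map_map]
  congr 1
  refine Multiset.map_congr rfl fun k hk => ?_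
  rw [Function.comp_apply, coe_substAlgHom, subst_permVars_psum (lam.2.parts_pos hk)]

theorem subst_permVars_of_mem_LambdaSharp {f : Series} (hf : f ∈ LambdaSharp)
    (π : Equiv.Perm ℕ) : subst (permVars π) f = f := by
  obtain ⟨c, hc⟩ := hf
  ext d
  have hd : d = (d.mapDomain π.symm).mapDomain π := by
    rw [← Finsupp.mapDomain_comp, Equiv.self_comp_symm, Finsupp.mapDomain_id]
  rw [hd, coeff_subst_permVars, (hc _).2, (hc _).2]
  refine finsum_congr fun lam => ?_
  rw [← coeff_subst_permVars π (partProd psum lam), subst_permVars_partProd_psum]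

theorem mem_gammaHat_of_mem_GGammaSharp {f : Series} (hf : f ∈ GGammaSharp) : f ∈ gammaHat := by
  classical
  refine mem_gammaHat.mpr ⟨subst_permVars_of_mem_LambdaSharp hf.1, ?_⟩
  -- Setting `t = 0` does not affect a series without monomials containing `t`.
  let a : Option ℕ → K := fun o => if o = none then 0 else 1
  have ha : HasSubst (a • X : Option ℕ → MvPowerSeries (Option ℕ) K) := HasSubst.smul_X a
  have h1 : subst (a • X : Option ℕ → MvPowerSeries (Option ℕ) K) (subst cancelVars f) =
      subst cancelVars f := by
    rw [← rescale_eq_subst]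
    ext d
    rw [coeff_rescale]
    by_cases hd : d none = 0
    · rw [Finsupp.prod, Finset.prod_eq_one, one_mul]
      intro i hi
      have : i ≠ none := by
        rintro rfl
        exact Finsupp.mem_support_iff.mp hi hd
      simp [a, this]
    · rw [hf.2 d hd, mul_zero]
  rw [← h1, subst_comp_subst_apply hasSubst_cancelVars ha]
  congr 1
  funext i
  match i with
  | 0 => simp [cancelVars, cancelZero, subst_X ha, a]
  | 1 =>
    rw [cancelVars, subst_bar ha (by simp), subst_X ha]
    simp [cancelZero, a, bar_zero]
  | i + 2 => simp [cancelVars, cancelZero, subst_X ha, a]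

/-! ### The deformed power sums -/

theorem coeffLimit_pBeta {n : ℕ} (hn : 0 < n) :
    CoeffLimit (fun S => ∑ i ∈ S, half (X i : Series) ^ n) (pBeta n) := by
  have h := (coeffLimit_psum hn).subst hasSubst_halfVars
  have heq : (fun S : Finset ℕ => ∑ i ∈ S, half (X i : Series) ^ n) =
      fun S => subst halfVars (∑ i ∈ S, (X i : Series) ^ n) := by
    funext S
    rw [← coe_substAlgHom hasSubst_halfVars, map_sum]
    refine Finset.sum_congr rfl fun i _ => ?_
    rw [coe_substAlgHom, subst_pow hasSubst_halfVars, subst_X hasSubst_halfVars]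
    rfl
  rw [heq]
  exact h

theorem subst_sum_half_pow {σ : Type*} {a : ℕ → MvPowerSeries σ K} (ha : HasSubst a) (n : ℕ)
    (S : Finset ℕ) :
    subst a (∑ i ∈ S, half (X i : Series) ^ n) = ∑ i ∈ S, half (a i) ^ n := by
  rw [← coe_substAlgHom ha, map_sum]
  refine Finset.sum_congr rfl fun i _ => ?_
  rw [coe_substAlgHom, subst_pow ha, subst_half ha (by simp), subst_X ha]

theorem pBeta_mem_gammaHat {n : ℕ} (hn : Odd n) : pBeta n ∈ gammaHat := by
  refine (coeffLimit_pBeta hn.pos).mem_gammaHat (fun π S => ?_) fun S hS => ?_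
  · rw [subst_sum_half_pow (hasSubst_permVars π), Finset.sum_map]
    rfl
  · rw [subst_sum_half_pow hasSubst_cancelVars, subst_sum_half_pow hasSubst_cancelZero]
    refine sum_eq_sum_of_pair hS ?_ fun i => rfl
    simp only [cancelVars, cancelZero]
    rw [half_bar (by simp), hn.neg_pow, half_zero, zero_pow hn.pos.ne']
    simp

theorem leadingForm_psum {n : ℕ} : LeadingForm n (psum n) (psum n) := by
  have h : ∀ d : ℕ →₀ ℕ, d.degree ≠ n → coeff d (psum n) = 0 := by
    intro d hd
    refine if_neg ?_
    rintro ⟨i, rfl⟩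
    simp at hd
  exact ⟨fun d hd => h d hd.ne, fun d _ => rfl, h⟩

theorem leadingForm_pBeta (n : ℕ) : LeadingForm n (pBeta n) (psum n) := by
  have h := (leadingForm_psum (n := n)).subst hasSubst_halfVars HasSubst.X
    fun i => (LeadingForm.X i).half
  rwa [subst_self] at h

/-! ### The deformed `q`-functions -/

section Ratio

variable {A B : Type*} [CommRing A] [CommRing B]

/-- The power series `(1 - y z) / (1 - x z)` in `z`. -/
def ratio (y x : A) : PowerSeries A :=
  (1 - PowerSeries.C y * PowerSeries.X) *
    PowerSeries.invOfUnit (1 - PowerSeries.C x * PowerSeries.X) 1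

theorem ratio_mul_one_sub (y x : A) :
    ratio y x * (1 - PowerSeries.C x * PowerSeries.X) = 1 - PowerSeries.C y * PowerSeries.X := by
  have h := PowerSeries.mul_invOfUnit (1 - PowerSeries.C x * PowerSeries.X) 1 (by simp)
  rw [ratio]
  linear_combination (1 - PowerSeries.C y * PowerSeries.X) * h

theorem eq_ratio {y x : A} {F : PowerSeries A}
    (hF : F * (1 - PowerSeries.C x * PowerSeries.X) = 1 - PowerSeries.C y * PowerSeries.X) :
    F = ratio y x := by
  have h := PowerSeries.mul_invOfUnit (1 - PowerSeries.C x * PowerSeries.X) 1 (by simp)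
  rw [ratio, ← hF]
  linear_combination -F * h

theorem ratio_self (x : A) : ratio x x = 1 :=
  (eq_ratio (one_mul _)).symm

theorem ratio_mul_ratio (y x : A) : ratio y x * ratio x y = 1 := by
  have h := PowerSeries.mul_invOfUnit (1 - PowerSeries.C x * PowerSeries.X) 1 (by simp)
  have h' := ratio_mul_one_sub x y
  rw [ratio, mul_right_comm, mul_comm (1 - _) (ratio x y), h', h]

theorem map_ratio (φ : A →+* B) (y x : A) :
    PowerSeries.map φ (ratio y x) = ratio (φ y) (φ x) := by
  refine eq_ratio ?_
  have h := congrArg (PowerSeries.map φ) (ratio_mul_one_sub y x)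
  simpa using h

theorem rescale_neg_one_ratio (y x : A) :
    PowerSeries.rescale (-1) (ratio y x) = ratio (-y) (-x) := by
  refine eq_ratio ?_
  have h := congrArg (PowerSeries.rescale (-1)) (ratio_mul_one_sub y x)
  have hc : ∀ a : A, PowerSeries.rescale (-1) (PowerSeries.C a) = PowerSeries.C a := by
    intro a
    ext n
    rw [PowerSeries.coeff_rescale, PowerSeries.coeff_C]
    split_ifs with hn <;> simp [hn]
  have hX : PowerSeries.rescale (-1 : A) PowerSeries.X = -PowerSeries.X := by
    simp
  simp only [map_mul, map_sub, map_one, hc, hX] at h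
  simpa using h

theorem coeff_zero_ratio (y x : A) : PowerSeries.coeff 0 (ratio y x) = 1 := by
  have h := congrArg (PowerSeries.coeff 0) (ratio_mul_one_sub y x)
  simpa using h

theorem coeff_succ_ratio (y x : A) (n : ℕ) :
    PowerSeries.coeff (n + 1) (ratio y x) = x ^ (n + 1) - y * x ^ n := by
  induction n with
  | zero =>
    have h := congrArg (PowerSeries.coeff 1) (ratio_mul_one_sub y x)
    rw [mul_sub, mul_one, ← mul_assoc, mul_comm _ (PowerSeries.C x), mul_assoc, map_sub, map_sub,
      PowerSeries.coeff_C_mul, show (1 : ℕ) = 0 + 1 from rfl, PowerSeries.coeff_succ_mul_X,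
      PowerSeries.coeff_succ_mul_X, coeff_zero_ratio] at h
    simp only [PowerSeries.coeff_one, zero_add, one_ne_zero, if_false,
      PowerSeries.coeff_zero_C] at h
    rw [zero_add, pow_one, pow_zero, mul_one]
    linear_combination h
  | succ n ih =>
    have h := congrArg (PowerSeries.coeff (n + 2)) (ratio_mul_one_sub y x)
    rw [mul_sub, mul_one, ← mul_assoc, mul_comm _ (PowerSeries.C x), mul_assoc] at h
    simp only [map_sub, PowerSeries.coeff_C_mul, PowerSeries.coeff_succ_mul_X, ih,
      PowerSeries.coeff_one] at h
    simp at h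
    linear_combination h

end Ratio

theorem qFactor_eq_ratio (i : ℕ) : qFactor i = ratio (bar (X i)) (X i) := rfl

theorem coeffLimit_qBeta (n : ℕ) :
    CoeffLimit (fun S => PowerSeries.coeff n (∏ i ∈ S, qFactor i)) (qBeta n) := by
  intro d
  -- a factor with index outside of the support of `d` does not change the coefficient at `d`
  have key : ∀ (G : PowerSeries Series) (T : Finset ℕ), (∀ i ∈ T, d i = 0) →
      coeff d (PowerSeries.coeff n ((∏ i ∈ T, qFactor i) * G)) =
        coeff d (PowerSeries.coeff n G) := by
    intro G T
    induction T using Finset.induction_on with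
    | empty => simp
    | insert i T hi ih =>
      intro hT
      obtain ⟨g, hg⟩ := qFactor_sub_one i
      have hz := (X_dvd_iff (R := K)).mp
        (Dvd.intro (PowerSeries.coeff n ((∏ i ∈ T, qFactor i) * g * G)) rfl) d (hT i (by simp))
      rw [Finset.prod_insert hi, hg, show (1 + PowerSeries.C (X i : Series) * g) *
        (∏ i ∈ T, qFactor i) * G = (∏ i ∈ T, qFactor i) * G +
          PowerSeries.C (X i : Series) * ((∏ i ∈ T, qFactor i) * g * G) by ring, map_add, map_add,
        PowerSeries.coeff_C_mul, hz, add_zero, ih fun j hj => hT j (by simp [hj])]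
  filter_upwards [eventually_ge_atTop (Finset.range (d.support.sup id + 1))] with S hS
  rw [← coeff_qBeta n d _ le_rfl, ← Finset.prod_sdiff hS, key]
  intro i hi
  by_contra h
  have h1 : i ≤ d.support.sup id := Finset.le_sup (f := id) (Finsupp.mem_support_iff.mpr h)
  simp only [Finset.mem_sdiff, Finset.mem_range] at hi
  omega

theorem subst_coeff_prod_qFactor {σ : Type*} {a : ℕ → MvPowerSeries σ K} (ha : HasSubst a)
    (n : ℕ) (S : Finset ℕ) :
    subst a (PowerSeries.coeff n (∏ i ∈ S, qFactor i)) =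
      PowerSeries.coeff n (∏ i ∈ S, ratio (bar (a i)) (a i)) := by
  let φ : Series →+* MvPowerSeries σ K := substAlgHom (R := K) ha
  have hφ : ∀ f, φ f = subst a f := fun f => substAlgHom_apply ha f
  rw [← hφ, ← PowerSeries.coeff_map, map_prod]
  congr 1
  refine Finset.prod_congr rfl fun i _ => ?_
  rw [qFactor_eq_ratio, map_ratio, hφ, hφ, subst_bar ha (by simp), subst_X ha]

theorem qBeta_mem_gammaHat (n : ℕ) : qBeta n ∈ gammaHat := by
  refine (coeffLimit_qBeta n).mem_gammaHat (fun π S => ?_) fun S hS => ?_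
  · rw [subst_coeff_prod_qFactor (hasSubst_permVars π), Finset.prod_map]
    rfl
  · rw [subst_coeff_prod_qFactor hasSubst_cancelVars, subst_coeff_prod_qFactor hasSubst_cancelZero]
    refine congrArg _ (prod_eq_prod_of_pair hS ?_ fun i => rfl)
    simp only [cancelVars, cancelZero]
    rw [bar_bar (by simp), ratio_mul_ratio, bar_zero, ratio_self, one_mul]

/-- Membership in `gammaHat` is inherited by `f(x̄)`: replacing `t` and all `xᵢ` by `t̄` and `x̄ᵢ`
turns the cancellation property of `f` into that of `f(x̄)`. -/
theorem subst_barVars_mem_gammaHat {f : Series} (hf : f ∈ gammaHat) :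
    subst barVars f ∈ gammaHat := by
  obtain ⟨h1, h2⟩ := mem_gammaHat.mp hf
  have hb := hasSubst_barVars
  refine mem_gammaHat.mpr ⟨fun π => ?_, ?_⟩
  · conv_rhs => rw [← h1 π]
    rw [subst_comp_subst_apply hb (hasSubst_permVars π),
      subst_comp_subst_apply (hasSubst_permVars π) hb]
    congr 1
    funext i
    rw [barVars, subst_bar (hasSubst_permVars π) (by simp), subst_X (hasSubst_permVars π),
      permVars, subst_X hb, barVars]
  · let b : Option ℕ → MvPowerSeries (Option ℕ) K := fun o => bar (X o)
    have hbb : HasSubst b := by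
      have h : b = fun i => (X i : MvPowerSeries (Option ℕ) K) * -(1 + C β * X i)⁻¹ := by
        funext i
        simp [b, bar]
      rw [h]
      exact HasSubst.X.mul_right _
    have hX : ∀ o, subst b (X o : MvPowerSeries (Option ℕ) K) = bar (X o) := fun o => subst_X hbb o
    have key : ∀ {a : ℕ → MvPowerSeries (Option ℕ) K}, HasSubst a →
        (∀ i, subst b (a i) = bar (a i)) →
        subst a (subst barVars f) = subst b (subst a f) := by
      intro a ha hba
      rw [subst_comp_subst_apply hb ha, subst_comp_subst_apply ha hbb]
      congr 1
      funext i
      rw [hba, barVars, subst_bar ha (by simp), subst_X ha]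
    rw [key hasSubst_cancelVars, key hasSubst_cancelZero, h2]
    · intro i
      have h0 : subst b (0 : MvPowerSeries (Option ℕ) K) = bar 0 := by
        rw [← coe_substAlgHom hbb, map_zero, bar_zero]
      match i with
      | 0 => exact h0
      | 1 => exact h0
      | i + 2 => exact hX _
    · intro i
      match i with
      | 0 => exact hX _
      | 1 =>
        simp only [cancelVars]
        rw [subst_bar hbb (by simp), hX]
      | i + 2 => exact hX _

/-- The homogeneous component of degree `n` of `qBeta n`. It is the coefficient `Qₙ` of `zⁿ` in
`Q(z) = ∏ᵢ (1 + xᵢ z) / (1 - xᵢ z)`, see `coeffLimit_qLead`. -/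
def qLead (n : ℕ) : Series := fun d => if d.degree = n then coeff d (qBeta n) else 0

theorem coeff_qLead (n : ℕ) (d : ℕ →₀ ℕ) :
    coeff d (qLead n) = if d.degree = n then coeff d (qBeta n) else 0 := rfl

/-- Leading forms of the coefficients of a product of power series in `z`, where the coefficient of
`z^k` has leading form of degree `k`. -/
theorem LeadingForm.coeff_prod {σ R ι : Type*} [CommRing R]
    {F G : ι → PowerSeries (MvPowerSeries σ R)}
    (h : ∀ i k, LeadingForm k (PowerSeries.coeff k (F i)) (PowerSeries.coeff k (G i)))
    (S : Finset ι) (n : ℕ) :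
    LeadingForm n (PowerSeries.coeff n (∏ i ∈ S, F i)) (PowerSeries.coeff n (∏ i ∈ S, G i)) := by
  classical
  induction S using Finset.induction_on generalizing n with
  | empty =>
    simp only [Finset.prod_empty, PowerSeries.coeff_one]
    split_ifs with hn
    · exact hn ▸ LeadingForm.one
    · exact LeadingForm.zero n
  | insert i S hi ih =>
    rw [Finset.prod_insert hi, Finset.prod_insert hi, PowerSeries.coeff_mul, PowerSeries.coeff_mul]
    refine LeadingForm.sum _ fun p hp => ?_
    rw [← Finset.HasAntidiagonal.mem_antidiagonal.mp hp]
    exact (h i p.1).mul (ih p.2)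

theorem leadingForm_coeff_prod_qFactor (S : Finset ℕ) (n : ℕ) :
    LeadingForm n (PowerSeries.coeff n (∏ i ∈ S, qFactor i))
      (PowerSeries.coeff n (∏ i ∈ S, ratio (-X i : Series) (X i))) := by
  refine LeadingForm.coeff_prod (fun i k => ?_) S n
  rw [qFactor_eq_ratio]
  cases k with
  | zero =>
    rw [coeff_zero_ratio, coeff_zero_ratio]
    exact LeadingForm.one
  | succ k =>
    rw [coeff_succ_ratio, coeff_succ_ratio, sub_eq_add_neg, sub_eq_add_neg]
    have h := ((LeadingForm.X (R := K) i).pow k)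
    have h1 := (LeadingForm.X (R := K) i).pow (k + 1)
    have h2 := ((LeadingForm.X (R := K) i).bar.mul h).neg
    rw [mul_one] at h h1 h2
    rw [add_comm 1 k] at h2
    exact h1.add h2

theorem leadingForm_qBeta (n : ℕ) : LeadingForm n (qBeta n) (qLead n) := by
  refine ⟨fun d hd => ?_, fun d hd => ?_, fun d hd => ?_⟩
  · obtain ⟨S, hS⟩ := (coeffLimit_qBeta n d).exists
    rw [← hS, (leadingForm_coeff_prod_qFactor S n).coeff_of_lt d hd]
  · rw [coeff_qLead, if_pos hd]
  · rw [coeff_qLead, if_neg hd]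

theorem coeffLimit_qLead (n : ℕ) :
    CoeffLimit (fun S => PowerSeries.coeff n (∏ i ∈ S, ratio (-X i : Series) (X i))) (qLead n) := by
  intro d
  filter_upwards [coeffLimit_qBeta n d] with S hS
  have h := leadingForm_coeff_prod_qFactor S n
  by_cases hd : d.degree = n
  · rw [← h.coeff_of_eq d hd, hS, (leadingForm_qBeta n).coeff_of_eq d hd]
  · rw [h.coeff_of_ne d hd, (leadingForm_qBeta n).coeff_of_ne d hd]

theorem qLead_zero : qLead 0 = 1 := by
  refine (coeffLimit_qLead 0).unique (CoeffLimit.const 1) (Eventually.of_forall fun S => ?_)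
  simp [map_prod, ← PowerSeries.coeff_zero_eq_constantCoeff_apply, coeff_zero_ratio]

/-- The relation `Q(z) Q(-z) = 1` for `Q(z) = ∏ᵢ (1 + xᵢ z) / (1 - xᵢ z)`. -/
theorem sum_neg_one_pow_mul_qLead {m : ℕ} (hm : 0 < m) :
    ∑ p ∈ Finset.HasAntidiagonal.antidiagonal m, (-1 : K) ^ p.2 • (qLead p.1 * qLead p.2) = 0 := by
  refine (CoeffLimit.sum _ fun p _ => ((coeffLimit_qLead p.1).mul (coeffLimit_qLead p.2)).smul
    ((-1 : K) ^ p.2)).unique (CoeffLimit.const 0) (Eventually.of_forall fun S => ?_)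
  have h : (∏ i ∈ S, ratio (-X i : Series) (X i)) *
      PowerSeries.rescale (-1) (∏ i ∈ S, ratio (-X i : Series) (X i)) = 1 := by
    rw [map_prod, ← Finset.prod_mul_distrib]
    refine Finset.prod_eq_one fun i _ => ?_
    rw [rescale_neg_one_ratio, neg_neg, ratio_mul_ratio]
  have h' := congrArg (PowerSeries.coeff m) h
  rw [PowerSeries.coeff_mul, PowerSeries.coeff_one, if_neg hm.ne'] at h'
  rw [← h']
  refine Finset.sum_congr rfl fun p _ => ?_
  rw [PowerSeries.coeff_rescale, mul_left_comm, MvPowerSeries.smul_eq_C_mul, map_pow, map_neg,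
    map_one]

/-- The coefficient of `z^k` in `z Q'(z) / Q(z)` for `Q(z) = ∏ᵢ (1 + xᵢ z) / (1 - xᵢ z)`. -/
def oddPsum (k : ℕ) : Series := if Odd k then (2 : K) • psum k else 0

/-- The logarithmic derivative of `(1 + x z) / (1 - x z)`, multiplied by `z`. -/
theorem X_mul_derivative_ratio {A : Type*} [CommRing A] (x : A) :
    PowerSeries.X * PowerSeries.derivative A (ratio (-x) x) = ratio (-x) x *
      PowerSeries.mk fun k => if Odd k then 2 * x ^ k else 0 := by
  set L : PowerSeries A := PowerSeries.mk fun k => if Odd k then 2 * x ^ k else 0 with hL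
  set Z : PowerSeries A := PowerSeries.X
  set c : PowerSeries A := PowerSeries.C x with hc
  -- the geometric series `L = 2xz / (1 - x²z²)`
  have h1 : L * (1 - c ^ 2 * Z ^ 2) = 2 * c * Z := by
    have h2 : (2 : PowerSeries A) * c * Z = PowerSeries.C (2 * x) * PowerSeries.X := by
      rw [map_mul, map_ofNat]
    rw [h2, mul_sub, mul_one, ← mul_assoc, mul_comm L, hc, ← map_pow, mul_assoc]
    ext k
    rw [map_sub, PowerSeries.coeff_C_mul, PowerSeries.coeff_C_mul, PowerSeries.coeff_mul_X_pow',
      PowerSeries.coeff_X, hL, PowerSeries.coeff_mk, PowerSeries.coeff_mk]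
    match k with
    | 0 => simp
    | 1 => simp
    | k + 2 =>
      have : Odd (k + 2) ↔ Odd k := by simp [Nat.odd_add]
      simp only [this, le_add_iff_nonneg_left, zero_le, if_true, Nat.add_sub_cancel]
      split_ifs with h h'
      · omega
      · ring
      · omega
      · ring
  have h2 : ratio (-x) x * (1 - c * Z) = 1 + c * Z := by
    rw [ratio_mul_one_sub, map_neg]
    ring
  have h3 : PowerSeries.derivative A (ratio (-x) x) * (1 - c * Z) - c * ratio (-x) x = c := by
    have h := congrArg (PowerSeries.derivative A) h2
    simp only [Derivation.leibniz, map_sub, map_add, Derivation.map_one_eq_zero, hc,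
      PowerSeries.derivative_C, Z, PowerSeries.derivative_X, smul_eq_mul] at h
    linear_combination h
  have hu := PowerSeries.mul_invOfUnit (1 - PowerSeries.C x * PowerSeries.X) 1 (by simp)
  have hv := PowerSeries.mul_invOfUnit (1 + PowerSeries.C x * PowerSeries.X) 1 (by simp)
  have hunit : IsUnit ((1 - c * Z) ^ 2 * (1 + c * Z)) :=
    ((IsUnit.of_mul_eq_one _ hu).pow 2).mul (IsUnit.of_mul_eq_one _ hv)
  refine hunit.mul_right_cancel ?_
  linear_combination Z * (1 - c * Z) * (1 + c * Z) * h3 + c * Z * (1 + c * Z) * h2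
    - ratio (-x) x * (1 - c * Z) * h1 - 2 * c * Z * h2

/-- The relation `z Q'(z) = Q(z) · 2 ∑ pₖ zᵏ` (`k` odd) for `Q(z) = ∏ᵢ (1 + xᵢ z) / (1 - xᵢ z)`. -/
theorem natCast_smul_qLead (n : ℕ) :
    (n : K) • qLead n =
      ∑ p ∈ Finset.HasAntidiagonal.antidiagonal n, oddPsum p.1 * qLead p.2 := by
  have hodd : ∀ k, CoeffLimit (fun S => PowerSeries.coeff k (∑ i ∈ S,
      PowerSeries.mk fun k => if Odd k then 2 * (X i : Series) ^ k else 0)) (oddPsum k) := by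
    intro k
    simp only [map_sum, PowerSeries.coeff_mk, oddPsum]
    split_ifs with hk
    · have h := (coeffLimit_psum hk.pos).smul (2 : K)
      simpa only [Finset.smul_sum, MvPowerSeries.smul_eq_C_mul, map_ofNat] using h
    · simpa using CoeffLimit.const (0 : Series)
  refine ((coeffLimit_qLead n).smul (n : K)).unique (CoeffLimit.sum _ fun p _ =>
    (hodd p.1).mul (coeffLimit_qLead p.2)) (Eventually.of_forall fun S => ?_)
  have h : ∀ S : Finset ℕ, PowerSeries.X * PowerSeries.derivative Series
      (∏ i ∈ S, ratio (-X i : Series) (X i)) = (∑ i ∈ S, PowerSeries.mk fun k =>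
        if Odd k then 2 * (X i : Series) ^ k else 0) * ∏ i ∈ S, ratio (-X i : Series) (X i) := by
    intro S
    induction S using Finset.induction_on with
    | empty => simp
    | insert i S hi ih =>
      have h1 := X_mul_derivative_ratio (X i : Series)
      rw [Finset.prod_insert hi, Finset.sum_insert hi, Derivation.leibniz, smul_eq_mul,
        smul_eq_mul]
      linear_combination ratio (-X i : Series) (X i) * ih +
        (∏ i ∈ S, ratio (-X i : Series) (X i)) * h1
  have h' := congrArg (PowerSeries.coeff n) (h S)
  rw [PowerSeries.coeff_mul n (∑ i ∈ S, _)] at h'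
  rw [← h']
  cases n with
  | zero => simp
  | succ n =>
    rw [PowerSeries.coeff_succ_X_mul, PowerSeries.coeff_derivative, MvPowerSeries.smul_eq_C_mul,
      map_natCast, mul_comm, Nat.cast_succ]

theorem leadingForm_qBarBeta (n : ℕ) : LeadingForm n (qBarBeta n) ((-1 : K) ^ n • qLead n) := by
  have hX : HasSubst (Function.const ℕ (-1 : K) • X : ℕ → Series) := HasSubst.smul_X _
  have h := (leadingForm_qBeta n).subst hasSubst_barVars hX fun i => by
    have h := (LeadingForm.X (R := K) i).bar
    simpa [barVars] using h
  rw [← rescale_eq_subst, rescale_homogeneous_eq_smul (n := n)] at h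
  · exact h
  · intro d hd
    by_contra hne
    exact hd ((leadingForm_qBeta n).coeff_of_ne d hne)

/-! ### Triangular expansions -/

theorem isFormalSum_iff_of_order {ι : Type*} {deg : ι → ℕ} {T : ℕ → Finset ι}
    (hT : ∀ n i, i ∈ T n ↔ deg i < n) {u : ι → Series}
    (hu : ∀ i d, d.degree < deg i → coeff d (u i) = 0) {c : ι → K} {f : Series} :
    IsFormalSum c u f ↔
      ∀ d, coeff d f = ∑ i ∈ T (d.degree + 1), c i * coeff d (u i) := by
  refine forall_congr' fun d => ?_
  have hsub : (Function.support fun i => c i * coeff d (u i)) ⊆ T (d.degree + 1) := by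
    intro i hi
    rw [Finset.mem_coe, hT]
    by_contra h
    exact hi (mul_eq_zero_of_right _ (hu i d (by omega)))
  rw [finsum_eq_sum_of_support_subset _ hsub]
  exact and_iff_right ((T (d.degree + 1)).finite_toSet.subset hsub)

/-- If the terms of degree `n` of every series of order at least `n` in `G` are a linear
combination, with unique coefficients, of the lowest terms of those `u i` with `deg i = n`, then
every member of `G` is in exactly one way an infinite linear combination of the `u i`. -/
theorem existsUnique_isFormalSum {ι : Type*} {deg : ι → ℕ} {fib T : ℕ → Finset ι}
    (hfib : ∀ n i, i ∈ fib n ↔ deg i = n) (hT : ∀ n i, i ∈ T n ↔ deg i < n)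
    {u : ι → Series} (hu : ∀ i d, d.degree < deg i → coeff d (u i) = 0)
    {G : Submodule K Series} (huG : ∀ i, u i ∈ G)
    (hspan : ∀ n, ∀ f ∈ G, (∀ d, d.degree < n → coeff d f = 0) →
      ∃ c : ι → K, ∀ d, d.degree = n → coeff d f = ∑ i ∈ fib n, c i * coeff d (u i))
    (hindep : ∀ n, ∀ c : ι → K,
      (∀ d, d.degree = n → ∑ i ∈ fib n, c i * coeff d (u i) = 0) → ∀ i ∈ fib n, c i = 0)
    {f : Series} (hf : f ∈ G) : ∃! c : ι → K, IsFormalSum c u f := by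
  classical
  have hTsucc : ∀ n, T (n + 1) = T n ∪ fib n := fun n => by
    ext i
    simp only [hT, hfib, Finset.mem_union]
    omega
  have hdisj : ∀ n, Disjoint (T n) (fib n) := fun n => by
    rw [Finset.disjoint_left]
    intro i hi hi'
    rw [hT] at hi
    rw [hfib] at hi'
    omega
  have hspan' : ∀ (n : ℕ) (g : Series), ∃ c : ι → K, g ∈ G →
      (∀ d, d.degree < n → coeff d g = 0) →
        ∀ d, d.degree = n → coeff d g = ∑ i ∈ fib n, c i * coeff d (u i) := by
    intro n g
    by_cases hg : g ∈ G ∧ ∀ d, d.degree < n → coeff d g = 0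
    · obtain ⟨c, hc⟩ := hspan n g hg.1 hg.2
      exact ⟨c, fun _ _ => hc⟩
    · exact ⟨0, fun h1 h2 => absurd ⟨h1, h2⟩ hg⟩
  choose c hc using hspan'
  -- the remainders, after the terms of degree less than `n` have been removed
  obtain ⟨r, hr0, hrs⟩ : ∃ r : ℕ → Series, r 0 = f ∧
      ∀ n, r (n + 1) = r n - ∑ i ∈ fib n, c n (r n) i • u i :=
    ⟨fun n => Nat.rec f (fun n g => g - ∑ i ∈ fib n, c n g i • u i) n, rfl, fun _ => rfl⟩
  let C : ι → K := fun i => c (deg i) (r (deg i)) i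
  have hr : ∀ n, r n = f - ∑ i ∈ T n, C i • u i := by
    intro n
    induction n with
    | zero =>
      have : T 0 = ∅ := Finset.eq_empty_of_forall_notMem fun i hi => by simp [hT] at hi
      rw [this, Finset.sum_empty, sub_zero, hr0]
    | succ n ih =>
      have h1 : ∑ i ∈ fib n, c n (r n) i • u i = ∑ i ∈ fib n, C i • u i := by
        refine Finset.sum_congr rfl fun i hi => ?_
        obtain rfl := (hfib n i).mp hi
        rfl
      rw [hrs, h1, ih, hTsucc, Finset.sum_union (hdisj n), sub_sub]
  have hrG : ∀ n, r n ∈ G := fun n => by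
    rw [hr]
    exact G.sub_mem hf (G.sum_mem fun i _ => G.smul_mem _ (huG i))
  have hrord : ∀ n d, d.degree < n → coeff d (r n) = 0 := by
    intro n
    induction n with
    | zero => exact fun d hd => absurd hd (Nat.not_lt_zero _)
    | succ n ih =>
      intro d hd
      rw [hrs, map_sub, map_sum]
      simp only [map_smul, smul_eq_mul]
      rcases Nat.lt_succ_iff_lt_or_eq.mp hd with h | h
      · rw [ih d h, zero_sub, neg_eq_zero]
        refine Finset.sum_eq_zero fun i hi => ?_
        rw [hu i d (by rw [(hfib n i).mp hi]; exact h), mul_zero]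
      · rw [hc n (r n) (hrG n) ih d h, sub_self]
  have hCsum : ∀ d, coeff d f = ∑ i ∈ T (d.degree + 1), C i * coeff d (u i) := fun d => by
    have h := hrord (d.degree + 1) d (Nat.lt_succ_self _)
    rw [hr, map_sub, sub_eq_zero, map_sum] at h
    simpa using h
  refine ⟨C, ?_, ?_⟩
  · exact (isFormalSum_iff_of_order hT hu).mpr hCsum
  · intro c' hc'
    have h' := (isFormalSum_iff_of_order hT hu).mp hc'
    have key : ∀ n, ∀ i ∈ fib n, c' i = C i := by
      intro n
      induction n using Nat.strong_induction_on with
      | _ n ih =>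
        have hlow : ∀ i ∈ T n, c' i = C i := fun i hi =>
          ih (deg i) ((hT n i).mp hi) i ((hfib _ i).mpr rfl)
        intro i hi
        refine sub_eq_zero.mp (hindep n (fun i => c' i - C i) (fun d hd => ?_) i hi)
        have h := h' d
        have hT' : ∑ i ∈ T n, c' i * coeff d (u i) = ∑ i ∈ T n, C i * coeff d (u i) :=
          Finset.sum_congr rfl fun i hi => by rw [hlow i hi]
        rw [hCsum d, hd, hTsucc, Finset.sum_union (hdisj n), Finset.sum_union (hdisj n), hT'] at h
        simp only [sub_mul, Finset.sum_sub_distrib]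
        linear_combination -h
    exact funext fun i => key (deg i) i ((hfib _ i).mpr rfl)

/-! ### Straightening -/

theorem sum_map_sq_le_sq_sum (s : Multiset ℕ) : (s.map (· ^ 2)).sum ≤ s.sum ^ 2 := by
  induction s using Multiset.induction_on with
  | empty => simp
  | cons a s ih =>
    simp only [Multiset.map_cons, Multiset.sum_cons]
    nlinarith [Nat.zero_le (a * s.sum)]

/-- Let `Φ` be a function of finite multisets of natural numbers that ignores zeros and satisfies
the quadratic relations of Schur's `Q`-functions, `∑_{i+j=2k} (-1)^j Φ(i, j, …) = 0`. Then its
values are linear combinations of those at sets of positive numbers with the same sum. The relation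
expresses `Φ(k, k, …)` by values at multisets with a larger sum of squares. -/
theorem straighten {F V : Type*} [Field F] [CharZero F] [AddCommGroup V] [Module F V]
    {Φ : Multiset ℕ → V} (h0 : ∀ s, Φ (0 ::ₘ s) = Φ s)
    (hrel : ∀ k, 0 < k → ∀ s, ∑ p ∈ Finset.HasAntidiagonal.antidiagonal (2 * k),
      (-1 : F) ^ p.2 • Φ (p.1 ::ₘ p.2 ::ₘ s) = 0) (s : Multiset ℕ) :
    Φ s ∈ Submodule.span F (Φ '' {t | (t.Nodup ∧ 0 ∉ t) ∧ t.sum = s.sum}) := by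
  induction hm : s.sum ^ 2 - (s.map (· ^ 2)).sum + s.card using Nat.strong_induction_on
    generalizing s with
  | _ m ih =>
    by_cases hz : 0 ∈ s
    · obtain ⟨t, rfl⟩ := Multiset.exists_cons_of_mem hz
      have := ih _ (by simp [← hm]) t rfl
      rw [h0]
      simpa using this
    by_cases hs : s.Nodup
    · exact Submodule.subset_span ⟨s, ⟨⟨hs, hz⟩, rfl⟩, rfl⟩
    rw [Multiset.nodup_iff_le] at hs
    push Not at hs
    obtain ⟨a, ha⟩ := hs
    obtain ⟨t, rfl⟩ := Multiset.le_iff_exists_add.mp ha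
    have hst : (a ::ₘ a ::ₘ 0 + t : Multiset ℕ) = a ::ₘ a ::ₘ t := by simp
    rw [hst] at hz hm ⊢
    have ha0 : 0 < a := Nat.pos_of_ne_zero fun h => hz (by simp [h])
    have hmem : (a, a) ∈ Finset.HasAntidiagonal.antidiagonal (2 * a) := by
      rw [Finset.HasAntidiagonal.mem_antidiagonal]
      omega
    have h := hrel a ha0 t
    rw [← Finset.add_sum_erase _ _ hmem] at h
    have hΦ : Φ (a ::ₘ a ::ₘ t) = (-1 : F) ^ a • -∑ p ∈
        (Finset.HasAntidiagonal.antidiagonal (2 * a)).erase (a, a),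
          (-1 : F) ^ p.2 • Φ (p.1 ::ₘ p.2 ::ₘ t) := by
      rw [← eq_neg_of_add_eq_zero_left h, smul_smul, ← mul_pow]
      simp
    rw [hΦ]
    refine Submodule.smul_mem _ _ (Submodule.neg_mem _ (Submodule.sum_mem _ fun p hp =>
      Submodule.smul_mem _ _ ?_))
    obtain ⟨hne, hp⟩ := Finset.mem_erase.mp hp
    rw [Finset.HasAntidiagonal.mem_antidiagonal] at hp
    have hsum : (p.1 ::ₘ p.2 ::ₘ t).sum = (a ::ₘ a ::ₘ t).sum := by
      simp only [Multiset.sum_cons]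
      omega
    rw [← hsum]
    refine ih _ ?_ _ rfl
    have h1 := sum_map_sq_le_sq_sum (p.1 ::ₘ p.2 ::ₘ t)
    have h2 := sum_map_sq_le_sq_sum (a ::ₘ a ::ₘ t)
    have h3 : ((a ::ₘ a ::ₘ t).map (· ^ 2)).sum < ((p.1 ::ₘ p.2 ::ₘ t).map (· ^ 2)).sum := by
      have h4 : p.1 ≠ a := fun h => hne (Prod.ext h (by simp only; omega))
      have h5 : a ^ 2 + a ^ 2 < p.1 ^ 2 + p.2 ^ 2 := by
        zify at hp ⊢
        have h6 : 0 < ((p.1 : ℤ) - a) ^ 2 := by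
          have : (p.1 : ℤ) - a ≠ 0 := sub_ne_zero.mpr (by exact_mod_cast h4)
          positivity
        have h7 : (p.2 : ℤ) = 2 * a - p.1 := by linarith
        rw [h7]
        nlinarith
      simp only [Multiset.map_cons, Multiset.sum_cons]
      omega
    rw [hsum] at h1 ⊢
    simp only [Multiset.card_cons] at hm ⊢
    omega

/-! ### Coefficients of symmetric series -/

/-- The permutation of `ℕ` fixing `0` and acting as `π` on the positive numbers. -/
def shiftPerm (π : Equiv.Perm ℕ) : Equiv.Perm ℕ where
  toFun
    | 0 => 0
    | n + 1 => π n + 1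
  invFun
    | 0 => 0
    | n + 1 => π.symm n + 1
  left_inv
    | 0 => rfl
    | n + 1 => by simp
  right_inv
    | 0 => rfl
    | n + 1 => by simp

theorem exists_perm_getD_eq {l l' : List ℕ} (h : l.Perm l') :
    ∃ π : Equiv.Perm ℕ, ∀ i, l'.getD (π i) 0 = l.getD i 0 := by
  induction h with
  | nil => exact ⟨1, fun i => rfl⟩
  | cons x _ ih =>
    obtain ⟨π, hπ⟩ := ih
    refine ⟨shiftPerm π, fun i => ?_⟩
    match i with
    | 0 => rfl
    | i + 1 => simpa [shiftPerm] using hπ i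
  | swap x y l =>
    refine ⟨Equiv.swap 0 1, fun i => ?_⟩
    match i with
    | 0 => simp
    | 1 => simp
    | i + 2 => rw [Equiv.swap_apply_of_ne_of_ne (by omega) (by omega)]; simp
  | trans _ _ ih ih' =>
    obtain ⟨π, hπ⟩ := ih
    obtain ⟨π', hπ'⟩ := ih'
    exact ⟨π.trans π', fun i => by rw [Equiv.trans_apply, hπ', hπ]⟩

/-- The coefficient of a symmetric series at a monomial depends only on the multiset of its
exponents. -/
theorem coeff_toFinsupp_perm {g : Series} (hg : ∀ π, subst (permVars π) g = g) {l l' : List ℕ}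
    (h : l.Perm l') : coeff l.toFinsupp g = coeff l'.toFinsupp g := by
  obtain ⟨π, hπ⟩ := exists_perm_getD_eq h
  have hd : l'.toFinsupp = l.toFinsupp.mapDomain π := by
    ext j
    obtain ⟨i, rfl⟩ := π.surjective j
    rw [Finsupp.mapDomain_apply π.injective, List.toFinsupp_apply, List.toFinsupp_apply, hπ]
  rw [hd, ← coeff_subst_permVars π g, hg]

theorem degree_toFinsupp (l : List ℕ) : l.toFinsupp.degree = l.sum := by
  induction l with
  | nil => simp
  | cons x l ih =>
    rw [List.toFinsupp_cons_eq_single_add_embDomain, map_add, Finsupp.degree_single,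
      Finsupp.embDomain_eq_mapDomain, Finsupp.degree_mapDomain, ih, List.sum_cons]

theorem exists_toFinsupp_eq (d : ℕ →₀ ℕ) : ∃ l : List ℕ, l.toFinsupp = d := by
  refine ⟨(List.range (d.support.sup id + 1)).map d, ?_⟩
  ext i
  rw [List.toFinsupp_apply, List.getD_eq_getElem?_getD, List.getElem?_map]
  rcases lt_or_ge i (d.support.sup id + 1) with hi | hi
  · simp [List.getElem?_range hi]
  · have h0 : d i = 0 := by
      by_contra h
      have h1 : i ≤ d.support.sup id := Finset.le_sup (f := id) (Finsupp.mem_support_iff.mpr h)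
      omega
    rw [List.getElem?_eq_none (by simpa using hi)]
    simp [h0]

/-- The exponent vector `(a, b, e₀, e₁, …)`. -/
def consExp (a b : ℕ) (e : ℕ →₀ ℕ) : ℕ →₀ ℕ :=
  Finsupp.single 0 a + Finsupp.single 1 b + e.mapDomain (· + 2)

theorem add_two_injective : Function.Injective (fun i : ℕ => i + 2) :=
  fun i j h => by simpa using h

theorem consExp_apply_zero (a b : ℕ) (e : ℕ →₀ ℕ) : consExp a b e 0 = a := by
  have h : e.mapDomain (· + 2) 0 = 0 := Finsupp.mapDomain_of_notMem_range _ _ (by simp)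
  simp [consExp, h]

theorem consExp_apply_one (a b : ℕ) (e : ℕ →₀ ℕ) : consExp a b e 1 = b := by
  have h : e.mapDomain (· + 2) 1 = 0 := Finsupp.mapDomain_of_notMem_range _ _ (by simp)
  simp [consExp, h]

theorem consExp_apply_add_two (a b : ℕ) (e : ℕ →₀ ℕ) (i : ℕ) : consExp a b e (i + 2) = e i := by
  have h : e.mapDomain (· + 2) (i + 2) = e i := Finsupp.mapDomain_apply add_two_injective _ _
  simp [consExp, h]

theorem exists_consExp_eq (d : ℕ →₀ ℕ) : ∃ e, d = consExp (d 0) (d 1) e := by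
  refine ⟨d.comapDomain (· + 2) add_two_injective.injOn, ?_⟩
  ext i
  match i with
  | 0 => rw [consExp_apply_zero]
  | 1 => rw [consExp_apply_one]
  | i + 2 => rw [consExp_apply_add_two, Finsupp.comapDomain_apply]

theorem toFinsupp_cons_cons (a b : ℕ) (l : List ℕ) :
    (a :: b :: l).toFinsupp = consExp a b l.toFinsupp := by
  ext i
  match i with
  | 0 => rw [consExp_apply_zero]; rfl
  | 1 => rw [consExp_apply_one]; rfl
  | i + 2 => rw [consExp_apply_add_two]; rfl

theorem subst_monomial_consExp {u : ℕ → MvPowerSeries (Option ℕ) K} (hu : HasSubst u)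
    (hu2 : ∀ i, u (i + 2) = X (some i)) (a b : ℕ) (e : ℕ →₀ ℕ) :
    subst u (monomial (consExp a b e) (1 : K)) =
      u 0 ^ a * u 1 ^ b * monomial (e.mapDomain some) 1 := by
  have h1 : (monomial (consExp a b e) (1 : K) : Series) =
      X 0 ^ a * X 1 ^ b * monomial (e.mapDomain (· + 2)) 1 := by
    rw [X_pow_eq, X_pow_eq, monomial_mul_monomial, monomial_mul_monomial, one_mul, one_mul, consExp]
  rw [h1, subst_mul hu, subst_mul hu, subst_pow hu, subst_pow hu, subst_X hu, subst_X hu]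
  congr 1
  have h2 : Filter.TendstoCofinite (fun i : ℕ => i + 2) :=
    ⟨add_two_injective.tendsto_cofinite⟩
  have h3 : Filter.TendstoCofinite (some : ℕ → Option ℕ) :=
    ⟨(Option.some_injective ℕ).tendsto_cofinite⟩
  rw [← rename_monomial, ← rename_monomial, rename_eq_subst, rename_eq_subst,
    subst_comp_subst_apply (HasSubst.X_comp _) hu]
  congr 1
  funext i
  rw [Function.comp_apply, subst_X hu, hu2]
  rfl

theorem coeff_subst_eq_finsum_monomial {σ τ : Type*} {u : σ → MvPowerSeries τ K} (hu : HasSubst u)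
    (g : MvPowerSeries σ K) (d : τ →₀ ℕ) :
    coeff d (subst u g) = ∑ᶠ e, coeff e g * coeff d (subst u (monomial e (1 : K))) := by
  rw [coeff_subst hu]
  refine finsum_congr fun e => ?_
  rw [subst_monomial hu, map_one, one_mul, smul_eq_mul]

/-- The coefficient of `t^m x^e` in `g(t, -t, x) = g(0, 0, x)` for `m > 0`. -/
theorem sum_coeff_consExp {g : Series} (hg : subst cancelLin g = subst cancelZero g) {m : ℕ}
    (hm : 0 < m) (e : ℕ →₀ ℕ) :
    ∑ p ∈ Finset.HasAntidiagonal.antidiagonal m,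
      (-1 : K) ^ p.2 * coeff (consExp p.1 p.2 e) g = 0 := by
  classical
  let d : Option ℕ →₀ ℕ := Finsupp.single none m + e.mapDomain some
  have hnone : ∀ e' : ℕ →₀ ℕ, e'.mapDomain some none = 0 :=
    fun e' => Finsupp.mapDomain_of_notMem_range _ _ (by simp)
  have hsome : ∀ (e' : ℕ →₀ ℕ) i, e'.mapDomain some (some i) = e' i :=
    fun e' i => Finsupp.mapDomain_apply (Option.some_injective ℕ) _ _
  have hdn : d none = m := by simp [d, hnone]
  have hds : ∀ i, d (some i) = e i := by simp [d, hsome]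
  have hzero : coeff d (subst cancelZero g) = 0 := by
    rw [coeff_subst_eq_finsum_monomial hasSubst_cancelZero, finsum_eq_zero_of_forall_eq_zero]
    intro e'
    obtain ⟨e'', he''⟩ := exists_consExp_eq e'
    generalize e' 0 = a at he''
    generalize e' 1 = b at he''
    rw [he'', subst_monomial_consExp hasSubst_cancelZero fun _ => rfl]
    refine mul_eq_zero_of_right _ ?_
    simp only [cancelZero]
    rw [← pow_add]
    rcases Nat.eq_zero_or_pos (a + b) with h0 | h0
    · rw [h0, pow_zero, one_mul, coeff_monomial, if_neg]
      intro h
      have h2 := DFunLike.congr_fun h none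
      rw [hdn, hnone] at h2
      omega
    · rw [zero_pow h0.ne', zero_mul, LinearMap.map_zero]
  have hlin : ∀ a b e', coeff d (subst cancelLin (monomial (consExp a b e') (1 : K))) =
      if a + b = m ∧ e' = e then (-1) ^ b else 0 := by
    intro a b e'
    rw [subst_monomial_consExp hasSubst_cancelLin fun _ => rfl]
    have h1 : cancelLin 0 ^ a * cancelLin 1 ^ b * monomial (e'.mapDomain some) (1 : K) =
        C ((-1) ^ b) * monomial (Finsupp.single none (a + b) + e'.mapDomain some) 1 := by
      have hC : (C ((-1 : K) ^ b) : MvPowerSeries (Option ℕ) K) = (-1) ^ b := by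
        rw [map_pow, map_neg, map_one]
      simp only [cancelLin]
      rw [hC, neg_pow, mul_left_comm, ← pow_add, X_pow_eq, mul_assoc, monomial_mul_monomial,
        one_mul]
    rw [h1, coeff_C_mul, coeff_monomial]
    have h2 : d = Finsupp.single none (a + b) + e'.mapDomain some ↔ a + b = m ∧ e' = e := by
      constructor
      · intro h
        refine ⟨?_, Finsupp.ext fun i => ?_⟩
        · have h3 := DFunLike.congr_fun h none
          rw [hdn] at h3
          simpa [hnone] using h3.symm
        · have h3 := DFunLike.congr_fun h (some i)
          rw [hds] at h3
          simpa [hsome] using h3.symm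
      · rintro ⟨rfl, rfl⟩
        rfl
    simp only [h2, mul_ite, mul_one, mul_zero]
  rw [← hg, coeff_subst_eq_finsum_monomial hasSubst_cancelLin] at hzero
  rw [← hzero, finsum_eq_sum_of_support_subset (s := (Finset.HasAntidiagonal.antidiagonal m).image
    fun p => consExp p.1 p.2 e), Finset.sum_image]
  · refine Finset.sum_congr rfl fun p hp => ?_
    rw [hlin, if_pos ⟨Finset.HasAntidiagonal.mem_antidiagonal.mp hp, rfl⟩, mul_comm]
  · intro p _ q _ h
    have h0 := DFunLike.congr_fun h 0
    have h1 := DFunLike.congr_fun h 1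
    simp only [consExp_apply_zero, consExp_apply_one] at h0 h1
    exact Prod.ext h0 h1
  · intro e' he'
    obtain ⟨e'', he''⟩ := exists_consExp_eq e'
    rw [Function.mem_support, he'', hlin] at he'
    have h : e' 0 + e' 1 = m ∧ e'' = e := by
      by_contra h
      exact he' (by rw [if_neg h, mul_zero])
    rw [Finset.mem_coe, Finset.mem_image]
    refine ⟨(e' 0, e' 1), Finset.HasAntidiagonal.mem_antidiagonal.mpr h.1, ?_⟩
    rw [he'', h.2]
    simp only [consExp_apply_zero, consExp_apply_one]

/-- The linear functional on `gammaHom n` taking the coefficient at a monomial whose exponents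
form the multiset `s`. -/
def coeffFunctional (n : ℕ) (s : Multiset ℕ) : gammaHom n →ₗ[K] K :=
  (coeff s.toList.toFinsupp).comp (gammaHom n).subtype

theorem coeffFunctional_coe {n : ℕ} (l : List ℕ) (g : gammaHom n) :
    coeffFunctional n l g = coeff l.toFinsupp (g : Series) :=
  coeff_toFinsupp_perm g.2.2.1 (Multiset.coe_eq_coe.mp (Multiset.coe_toList _))

theorem coeffFunctional_zero_cons (n : ℕ) (s : Multiset ℕ) :
    coeffFunctional n (0 ::ₘ s) = coeffFunctional n s := by
  induction s using Quotient.inductionOn with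
  | _ l =>
    refine LinearMap.ext fun g => ?_
    have h1 : (0 ::ₘ (l : Multiset ℕ)) = ((l ++ [0] : List ℕ) : Multiset ℕ) := by
      rw [Multiset.cons_coe, Multiset.coe_eq_coe]
      exact (List.perm_append_singleton 0 l).symm
    change coeffFunctional n (0 ::ₘ (l : Multiset ℕ)) g = coeffFunctional n (l : Multiset ℕ) g
    rw [h1, coeffFunctional_coe, coeffFunctional_coe]
    congr 2
    ext i
    rw [List.toFinsupp_apply, List.toFinsupp_apply]
    rcases lt_or_ge i l.length with hi | hi
    · rw [List.getD_append _ _ _ _ hi]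
    · rw [List.getD_append_right _ _ _ _ hi, List.getD_eq_default _ _ hi]
      cases i - l.length <;> simp

/-- A homogeneous series of degree `n` with cancellation vanishes if its coefficients at all
monomials with distinct nonzero exponents do. -/
theorem eq_zero_of_coeff_strict {n : ℕ} {g : Series} (hg : g ∈ gammaHom n)
    (h : ∀ s : Multiset ℕ, s.Nodup → 0 ∉ s → s.sum = n → coeff s.toList.toFinsupp g = 0) :
    g = 0 := by
  ext d
  rw [map_zero]
  by_cases hd : d.degree = n
  · obtain ⟨l, rfl⟩ := exists_toFinsupp_eq d
    rw [degree_toFinsupp] at hd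
    have hst := straighten (F := K) (coeffFunctional_zero_cons n) (fun k hk s => by
      induction s using Quotient.inductionOn with
      | _ l =>
        refine LinearMap.ext fun g' => ?_
        have h1 := sum_coeff_consExp g'.2.2.2 (m := 2 * k) (by omega) l.toFinsupp
        rw [LinearMap.sum_apply, LinearMap.zero_apply, ← h1]
        refine Finset.sum_congr rfl fun p _ => ?_
        rw [LinearMap.smul_apply, smul_eq_mul, ← toFinsupp_cons_cons, ← coeffFunctional_coe]
        rfl) (l : Multiset ℕ)
    have hker : Submodule.span K (coeffFunctional n '' {t | (t.Nodup ∧ 0 ∉ t) ∧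
        t.sum = (l : Multiset ℕ).sum}) ≤
          LinearMap.ker (LinearMap.applyₗ (⟨g, hg⟩ : gammaHom n)) := by
      rw [Submodule.span_le]
      rintro _ ⟨t, ⟨⟨ht1, ht2⟩, ht3⟩, rfl⟩
      exact h t ht1 ht2 (by rw [ht3, ← hd]; simp)
    have := hker hst
    rw [LinearMap.mem_ker, LinearMap.applyₗ_apply_apply, coeffFunctional_coe] at this
    exact this
  · exact hg.1 d hd

/-- Evaluation of the coefficients at monomials with distinct nonzero exponents. -/
def strictCoeffs (n : ℕ) : gammaHom n →ₗ[K] (Nat.Partition.distincts n → K) :=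
  LinearMap.pi fun lam => coeffFunctional n lam.1.parts

theorem strictCoeffs_injective (n : ℕ) : Function.Injective (strictCoeffs n) := by
  rw [← LinearMap.ker_eq_bot, LinearMap.ker_eq_bot']
  rintro ⟨g, hg⟩ h
  refine Subtype.ext (eq_zero_of_coeff_strict hg fun s h1 h2 h3 => ?_)
  have hmem : (⟨s, fun {i} hi => Nat.pos_of_ne_zero fun h => h2 (h ▸ hi), h3⟩ : n.Partition) ∈
      Nat.Partition.distincts n := by
    simpa [Nat.Partition.distincts] using h1
  exact congrFun h ⟨_, hmem⟩

instance finite_gammaHom (n : ℕ) : Module.Finite K (gammaHom n) :=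
  Module.Finite.of_injective (strictCoeffs n) (strictCoeffs_injective n)

theorem finrank_gammaHom_le (n : ℕ) :
    Module.finrank K (gammaHom n) ≤ (Nat.Partition.distincts n).card := by
  refine (LinearMap.finrank_le_finrank_of_injective (strictCoeffs_injective n)).trans ?_
  simp

/-! ### Linear independence of the products of power sums -/

open Classical in
/-- The power sum with coefficients in `ℕ`, where a sum of nonzero terms cannot vanish. -/
def psumNat (n : ℕ) : MvPowerSeries ℕ ℕ :=
  fun d => if ∃ i : ℕ, d = Finsupp.single i n then 1 else 0

theorem map_psumNat (n : ℕ) : MvPowerSeries.map (Nat.castRingHom K) (psumNat n) = psum n := by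
  classical
  ext d
  rw [coeff_map]
  change ((if ∃ i : ℕ, d = Finsupp.single i n then 1 else 0 : ℕ) : K) =
    if ∃ i : ℕ, d = Finsupp.single i n then 1 else 0
  split_ifs <;> simp

theorem coeff_psumNat_ne_zero {n : ℕ} {d : ℕ →₀ ℕ} :
    coeff d (psumNat n) ≠ 0 ↔ ∃ i : ℕ, d = Finsupp.single i n := by
  classical
  change (if ∃ i : ℕ, d = Finsupp.single i n then 1 else 0) ≠ 0 ↔ _
  simp

theorem support_val_map_single_add {i k : ℕ} (hk : k ≠ 0) {b : ℕ →₀ ℕ} (hi : b i = 0) :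
    (Finsupp.single i k + b).support.val.map (Finsupp.single i k + b) =
      k ::ₘ b.support.val.map b := by
  classical
  have hsupp : (Finsupp.single i k + b).support = insert i b.support := by
    ext j
    by_cases hj : j = i
    · subst hj
      simp [hk]
    · simp [hj]
  rw [hsupp, Finset.insert_val_of_notMem (by simp [hi]), Multiset.map_cons]
  congr 1
  · simp [hi]
  · refine Multiset.map_congr rfl fun j hj => ?_
    have hj' : j ≠ i := by
      rintro rfl
      exact Finsupp.mem_support_iff.mp hj hi
    simp [hj'.symm]

/-- The monomials of `p_{k₁} ⋯ p_{k_ℓ}` involve at most `ℓ` variables, and those which involve `ℓ`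
variables have the exponents `k₁, …, k_ℓ`. -/
theorem card_support_le_of_coeff_psumNat {s : Multiset ℕ} (hs : 0 ∉ s) {d : ℕ →₀ ℕ}
    (hd : coeff d (s.map psumNat).prod ≠ 0) :
    d.support.card ≤ s.card ∧ (d.support.card = s.card → d.support.val.map d = s) := by
  classical
  induction s using Multiset.induction_on generalizing d with
  | empty =>
    rw [Multiset.map_zero, Multiset.prod_zero, coeff_one] at hd
    obtain rfl : d = 0 := by
      by_contra h
      exact hd (if_neg h)
    simp
  | cons k s ih =>
    rw [Multiset.mem_cons, not_or] at hs
    rw [Multiset.map_cons, Multiset.prod_cons, coeff_mul] at hd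
    obtain ⟨⟨a, b⟩, hab, hne⟩ := Finset.exists_ne_zero_of_sum_ne_zero hd
    rw [Finset.HasAntidiagonal.mem_antidiagonal] at hab
    obtain ⟨i, hi⟩ := coeff_psumNat_ne_zero.mp (left_ne_zero_of_mul hne)
    obtain ⟨h1, h2⟩ := ih hs.2 (right_ne_zero_of_mul hne)
    simp only at hab hi h1 h2
    subst hi
    subst hab
    by_cases hbi : b i = 0
    · have h := support_val_map_single_add (Ne.symm hs.1) hbi
      have hcard : (Finsupp.single i k + b).support.card = b.support.card + 1 := by
        simpa using congrArg Multiset.card h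
      rw [hcard, h, Multiset.card_cons]
      exact ⟨by omega, fun h3 => by rw [h2 (by omega)]⟩
    · have hsupp : (Finsupp.single i k + b).support = b.support := by
        ext j
        by_cases hj : j = i
        · subst hj
          simp [hbi]
        · simp [Ne.symm hj]
      rw [hsupp, Multiset.card_cons]
      exact ⟨by omega, fun h3 => by omega⟩

theorem coeff_psumNat_prod_ne_zero {s : Multiset ℕ} {d : ℕ →₀ ℕ}
    (hd : d.support.val.map d = s) : coeff d (s.map psumNat).prod ≠ 0 := by
  classical
  induction s using Multiset.induction_on generalizing d with
  | empty =>
    obtain rfl : d = 0 := by simpa using hd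
    simp
  | cons k s ih =>
    have hk : k ∈ d.support.val.map d := by simp [hd]
    obtain ⟨i, hi, rfl⟩ := Multiset.mem_map.mp hk
    have hdi : d i ≠ 0 := Finsupp.mem_support_iff.mp hi
    have h := support_val_map_single_add hdi (b := d.erase i) (Finsupp.erase_same)
    rw [Finsupp.single_add_erase, hd, Multiset.cons_inj_right] at h
    rw [Multiset.map_cons, Multiset.prod_cons, coeff_mul]
    have h1 : coeff (Finsupp.single i (d i)) (psumNat (d i)) *
        coeff (d.erase i) (s.map psumNat).prod ≠ 0 :=
      mul_ne_zero (coeff_psumNat_ne_zero.mpr ⟨i, rfl⟩) (ih h.symm)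
    refine (lt_of_lt_of_le (Nat.pos_of_ne_zero h1) ?_).ne'
    exact Finset.single_le_sum (f := fun p : (ℕ →₀ ℕ) × (ℕ →₀ ℕ) =>
      coeff p.1 (psumNat (d i)) * coeff p.2 (s.map psumNat).prod) (fun _ _ => Nat.zero_le _)
      (a := (Finsupp.single i (d i), d.erase i))
      (Finset.HasAntidiagonal.mem_antidiagonal.mpr (Finsupp.single_add_erase i d))

theorem coeff_psum_prod_ne_zero_iff (s : Multiset ℕ) (d : ℕ →₀ ℕ) :
    coeff d (s.map psum).prod ≠ 0 ↔ coeff d (s.map psumNat).prod ≠ 0 := by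
  have h : (s.map psum).prod = MvPowerSeries.map (Nat.castRingHom K) (s.map psumNat).prod := by
    rw [map_multiset_prod, Multiset.map_map]
    congr 1
    exact Multiset.map_congr rfl fun n _ => (map_psumNat n).symm
  rw [h, coeff_map]
  simp

theorem exists_support_val_map_eq {s : Multiset ℕ} (hs : 0 ∉ s) :
    ∃ d : ℕ →₀ ℕ, d.support.val.map d = s := by
  induction s using Multiset.induction_on with
  | empty => exact ⟨0, by simp⟩
  | cons k s ih =>
    rw [Multiset.mem_cons, not_or] at hs
    obtain ⟨d, hd⟩ := ih hs.2
    obtain ⟨i, hi⟩ := Infinite.exists_notMem_finset d.support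
    refine ⟨Finsupp.single i k + d, ?_⟩
    rw [support_val_map_single_add (Ne.symm hs.1) (by simpa using hi), hd]

/-- The products of power sums are linearly independent: if `λ` is a longest partition with
nonzero coefficient in a linear combination, then the monomial `x^λ` occurs. -/
theorem linearIndependent_psum_prod (n : ℕ) :
    LinearIndependent K fun lam : n.Partition => (lam.parts.map psum).prod := by
  classical
  rw [Fintype.linearIndependent_iff]
  intro c hc
  by_contra hne
  push Not at hne
  obtain ⟨lam0, hlam0⟩ := hne
  obtain ⟨lam, hlam, hmax⟩ := Finset.exists_max_image
    (Finset.univ.filter fun mu => c mu ≠ 0) (fun mu => mu.parts.card) ⟨lam0, by simpa using hlam0⟩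
  rw [Finset.mem_filter] at hlam
  have hpos : ∀ mu : n.Partition, 0 ∉ mu.parts := fun mu h => lt_irrefl 0 (mu.parts_pos h)
  obtain ⟨d, hd⟩ := exists_support_val_map_eq (hpos lam)
  have h := congrArg (coeff d) hc
  rw [map_sum, map_zero, Finset.sum_eq_single lam, map_smul, smul_eq_mul] at h
  · exact mul_ne_zero hlam.2
      ((coeff_psum_prod_ne_zero_iff _ _).mpr (coeff_psumNat_prod_ne_zero hd)) h
  · intro mu _ hmu
    rw [map_smul, smul_eq_mul]
    by_contra h1
    have h2 := card_support_le_of_coeff_psumNat (hpos mu)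
      ((coeff_psum_prod_ne_zero_iff _ _).mp (right_ne_zero_of_mul h1))
    have h3 := hmax mu (by simpa using left_ne_zero_of_mul h1)
    have h4 : d.support.card = lam.parts.card := by
      rw [← hd, Multiset.card_map]
      rfl
    refine hmu (Nat.Partition.ext ?_)
    rw [← h2.2 (by omega), hd]
  · simp

/-! ### Spanning families of products -/

/-- The span of the products of the `u k`, with `k` ranging over a multiset in `P` with sum `n`. -/
def prodSpan (u : ℕ → Series) (P : Set (Multiset ℕ)) (n : ℕ) : Submodule K Series :=
  Submodule.span K ((fun s => (s.map u).prod) '' {s | s ∈ P ∧ s.sum = n})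

/-- The multisets of odd numbers. -/
def oddMultisets : Set (Multiset ℕ) := {s | ∀ k ∈ s, Odd k}

/-- The multisets of distinct positive numbers. -/
def strictMultisets : Set (Multiset ℕ) := {s | s.Nodup ∧ 0 ∉ s}

theorem prod_mem_prodSpan {u : ℕ → Series} {P : Set (Multiset ℕ)} {s : Multiset ℕ} (hs : s ∈ P) :
    (s.map u).prod ∈ prodSpan u P s.sum :=
  Submodule.subset_span ⟨s, ⟨hs, rfl⟩, rfl⟩

theorem mul_mem_prodSpan_odd {u : ℕ → Series} {m n : ℕ} {f g : Series}
    (hf : f ∈ prodSpan u oddMultisets m) (hg : g ∈ prodSpan u oddMultisets n) :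
    f * g ∈ prodSpan u oddMultisets (m + n) := by
  have h := Submodule.mul_mem_mul hf hg
  rw [prodSpan, prodSpan, Submodule.span_mul_span] at h
  refine Submodule.span_mono ?_ h
  rintro _ ⟨_, ⟨s, ⟨hs, rfl⟩, rfl⟩, _, ⟨t, ⟨ht, rfl⟩, rfl⟩, rfl⟩
  refine ⟨s + t, ⟨fun k hk => ?_, Multiset.sum_add s t⟩, by simp⟩
  rcases Multiset.mem_add.mp hk with h | h
  exacts [hs k h, ht k h]

theorem one_mem_prodSpan_odd (u : ℕ → Series) : 1 ∈ prodSpan u oddMultisets 0 := by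
  simpa using prod_mem_prodSpan (u := u) (P := oddMultisets) (s := 0) (by simp [oddMultisets])

/-- The even `Q_m` are polynomials in the odd ones, by the relation `Q(z) Q(-z) = 1`. -/
theorem qLead_mem_prodSpan_odd (m : ℕ) : qLead m ∈ prodSpan qLead oddMultisets m := by
  classical
  induction m using Nat.strong_induction_on with
  | _ m ih =>
    rcases Nat.eq_zero_or_pos m with rfl | hm
    · rw [qLead_zero]
      exact one_mem_prodSpan_odd _
    rcases Nat.even_or_odd m with he | ho
    · have h := sum_neg_one_pow_mul_qLead hm
      have h1 : (m, 0) ∈ Finset.HasAntidiagonal.antidiagonal m := by simp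
      have h2 : (0, m) ∈ (Finset.HasAntidiagonal.antidiagonal m).erase (m, 0) := by
        simp [hm.ne]
      rw [← Finset.add_sum_erase _ _ h1, ← Finset.add_sum_erase _ _ h2] at h
      simp only [qLead_zero, mul_one, one_mul, pow_zero, one_smul, he.neg_one_pow] at h
      rw [← add_assoc, ← two_smul K] at h
      have h3 : qLead m = (2 : K)⁻¹ • -∑ p ∈ ((Finset.HasAntidiagonal.antidiagonal m).erase
          (m, 0)).erase (0, m), (-1 : K) ^ p.2 • (qLead p.1 * qLead p.2) := by
        rw [← eq_neg_of_add_eq_zero_left h, smul_smul, inv_mul_cancel₀ two_ne_zero, one_smul]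
      rw [h3]
      refine Submodule.smul_mem _ _ (Submodule.neg_mem _ (Submodule.sum_mem _ fun p hp =>
        Submodule.smul_mem _ _ ?_))
      simp only [Finset.mem_erase, Finset.HasAntidiagonal.mem_antidiagonal] at hp
      obtain ⟨hp1, hp2, hp3⟩ := hp
      have h4 : p.1 ≠ 0 := fun h => hp1 (Prod.ext h (by simp only; omega))
      have h5 : p.2 ≠ 0 := fun h => hp2 (Prod.ext (by simp only; omega) h)
      rw [← hp3]
      exact mul_mem_prodSpan_odd (ih p.1 (by omega)) (ih p.2 (by omega))
    · have h := prod_mem_prodSpan (u := qLead) (P := oddMultisets) (s := {m})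
        (by simpa [oddMultisets] using ho)
      simpa using h

/-- Newton-type recursion: `z Q'(z) / Q(z)` has coefficients polynomial in the odd `Q_m`. -/
theorem oddPsum_mem_prodSpan_odd (m : ℕ) : oddPsum m ∈ prodSpan qLead oddMultisets m := by
  classical
  induction m using Nat.strong_induction_on with
  | _ m ih =>
    have h := natCast_smul_qLead m
    have h1 : (m, 0) ∈ Finset.HasAntidiagonal.antidiagonal m := by simp
    rw [← Finset.add_sum_erase _ _ h1] at h
    simp only [qLead_zero, mul_one] at h
    rw [eq_sub_of_add_eq h.symm]
    refine Submodule.sub_mem _ (Submodule.smul_mem _ _ (qLead_mem_prodSpan_odd m))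
      (Submodule.sum_mem _ fun p hp => ?_)
    simp only [Finset.mem_erase, Finset.HasAntidiagonal.mem_antidiagonal] at hp
    obtain ⟨hp1, hp2⟩ := hp
    have h2 : p.2 ≠ 0 := fun h => hp1 (Prod.ext (by simp only; omega) h)
    rw [← hp2]
    exact mul_mem_prodSpan_odd (ih p.1 (by omega)) (qLead_mem_prodSpan_odd p.2)

theorem prodSpan_psum_le_prodSpan_qLead (n : ℕ) :
    prodSpan psum oddMultisets n ≤ prodSpan qLead oddMultisets n := by
  refine Submodule.span_le.mpr ?_
  rintro _ ⟨s, ⟨hs, rfl⟩, rfl⟩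
  simp only [SetLike.mem_coe]
  induction s using Multiset.induction_on with
  | empty => simpa using one_mem_prodSpan_odd qLead
  | cons k s ih =>
    rw [Multiset.map_cons, Multiset.prod_cons, Multiset.sum_cons]
    refine mul_mem_prodSpan_odd ?_ (ih fun j hj => hs j (Multiset.mem_cons_of_mem hj))
    have h := Submodule.smul_mem _ (2 : K)⁻¹ (oddPsum_mem_prodSpan_odd k)
    rwa [oddPsum, if_pos (hs k (Multiset.mem_cons_self k s)), smul_smul,
      inv_mul_cancel₀ two_ne_zero, one_smul] at h

theorem prodSpan_odd_le_prodSpan_strict (n : ℕ) :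
    prodSpan qLead oddMultisets n ≤ prodSpan qLead strictMultisets n := by
  refine Submodule.span_le.mpr ?_
  rintro _ ⟨s, ⟨-, rfl⟩, rfl⟩
  refine straighten (F := K) (Φ := fun s => (s.map qLead).prod) (fun s => ?_)
    (fun k hk s => ?_) s
  · simp [qLead_zero]
  · have h := congrArg (· * (s.map qLead).prod) (sum_neg_one_pow_mul_qLead (m := 2 * k) (by omega))
    simp only [Finset.sum_mul, zero_mul] at h
    rw [← h]
    refine Finset.sum_congr rfl fun p _ => ?_
    simp [mul_assoc]

theorem card_oddMultisets_eq (n : ℕ) :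
    Nat.card {lam : n.Partition // lam.parts ∈ oddMultisets} =
      (Nat.Partition.distincts n).card := by
  classical
  rw [← Nat.Partition.card_odds_eq_card_distincts, Nat.card_eq_fintype_card, Fintype.card_subtype]
  congr 1
  ext lam
  rw [Finset.mem_filter]
  simp [Nat.Partition.odds, Nat.Partition.restricted, oddMultisets]

theorem card_strictMultisets_eq (n : ℕ) :
    Nat.card {lam : n.Partition // lam.parts ∈ strictMultisets} =
      (Nat.Partition.distincts n).card := by
  classical
  rw [Nat.card_eq_fintype_card, Fintype.card_subtype]
  congr 1
  ext lam
  have : 0 ∉ lam.parts := fun h => lt_irrefl 0 (lam.parts_pos h)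
  rw [Finset.mem_filter]
  simp [Nat.Partition.distincts, strictMultisets, this]

theorem partProd_mem_gammaHat {u : ℕ → Series} {lam : Partitions}
    (h : ∀ k ∈ lam.2.parts, u k ∈ gammaHat) : partProd u lam ∈ gammaHat := by
  refine gammaHat.multiset_prod_mem fun f hf => ?_
  obtain ⟨k, hk, rfl⟩ := Multiset.mem_map.mp hf
  exact h k hk

theorem leadingForm_partProd {u B : ℕ → Series} {lam : Partitions}
    (h : ∀ k ∈ lam.2.parts, LeadingForm k (u k) (B k)) :
    LeadingForm lam.1 (partProd u lam) (partProd B lam) := by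
  have h1 := LeadingForm.multisetProd lam.2.parts h
  rwa [lam.2.parts_sum] at h1

/-- The product of power sums attached to a partition of `n` into odd parts, in `gammaHom n`. -/
def oddPsumProd (n : ℕ) (lam : {lam : n.Partition // lam.parts ∈ oddMultisets}) : gammaHom n :=
  ⟨(lam.1.parts.map psum).prod, (leadingForm_partProd (lam := ⟨n, lam.1⟩)
    fun k _ => leadingForm_pBeta k).mem_gammaHom
      (partProd_mem_gammaHat fun k hk => pBeta_mem_gammaHat (lam.2 k hk))⟩

theorem linearIndependent_oddPsumProd (n : ℕ) : LinearIndependent K (oddPsumProd n) :=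
  LinearIndependent.of_comp (gammaHom n).subtype
    ((linearIndependent_psum_prod n).comp _ Subtype.val_injective)

/-- By Euler's partition theorem, the products of odd power sums are as many as the upper bound
`finrank_gammaHom_le` for the dimension. -/
theorem finrank_gammaHom (n : ℕ) :
    Module.finrank K (gammaHom n) = (Nat.Partition.distincts n).card := by
  classical
  refine le_antisymm (finrank_gammaHom_le n) ?_
  rw [← card_oddMultisets_eq, Nat.card_eq_fintype_card]
  exact (linearIndependent_oddPsumProd n).fintype_card_le_finrank

theorem gammaHom_le_prodSpan_psum (n : ℕ) : gammaHom n ≤ prodSpan psum oddMultisets n := by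
  classical
  have htop := (linearIndependent_oddPsumProd n).span_eq_top_of_card_eq_finrank' (by
    rw [finrank_gammaHom, ← card_oddMultisets_eq, Nat.card_eq_fintype_card])
  intro g hg
  have h : (⟨g, hg⟩ : gammaHom n) ∈ Submodule.span K (Set.range (oddPsumProd n)) :=
    htop ▸ Submodule.mem_top
  have h1 := Submodule.mem_map_of_mem (f := (gammaHom n).subtype) h
  rw [Submodule.map_span] at h1
  refine Submodule.span_mono ?_ h1
  rintro _ ⟨_, ⟨lam, rfl⟩, rfl⟩
  exact ⟨lam.1.parts, ⟨lam.2, lam.1.parts_sum⟩, rfl⟩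

theorem gammaHom_le_prodSpan_qLead_odd (n : ℕ) : gammaHom n ≤ prodSpan qLead oddMultisets n :=
  (gammaHom_le_prodSpan_psum n).trans (prodSpan_psum_le_prodSpan_qLead n)

theorem gammaHom_le_prodSpan_qLead_strict (n : ℕ) :
    gammaHom n ≤ prodSpan qLead strictMultisets n :=
  (gammaHom_le_prodSpan_qLead_odd n).trans (prodSpan_odd_le_prodSpan_strict n)

/-- Replacing `Q_k` by `(-1)^k Q_k` multiplies each product by a sign. -/
theorem prodSpan_le_prodSpan_neg_one_pow_smul (u : ℕ → Series) (P : Set (Multiset ℕ)) (n : ℕ) :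
    prodSpan u P n ≤ prodSpan (fun k => (-1 : K) ^ k • u k) P n := by
  refine Submodule.span_le.mpr ?_
  rintro _ ⟨s, ⟨hs, rfl⟩, rfl⟩
  have key : ∀ s : Multiset ℕ,
      (s.map u).prod = (-1 : K) ^ s.sum • (s.map fun k => (-1 : K) ^ k • u k).prod := by
    intro s
    induction s using Multiset.induction_on with
    | empty => simp
    | cons k s ih =>
      simp only [Multiset.map_cons, Multiset.prod_cons, Multiset.sum_cons]
      rw [ih, pow_add, smul_mul_assoc, mul_smul_comm, smul_smul, mul_right_comm, ← mul_pow]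
      simp
  simp only [SetLike.mem_coe]
  rw [key]
  exact Submodule.smul_mem _ _ (prod_mem_prodSpan hs)

/-! ### Unique expansions -/

theorem prodSpan_eq_span_range (B : ℕ → Series) {P : Set (Multiset ℕ)} (hP : ∀ s ∈ P, 0 ∉ s)
    (n : ℕ) : prodSpan B P n = Submodule.span K (Set.range
      fun lam : {lam : n.Partition // lam.parts ∈ P} => (lam.1.parts.map B).prod) := by
  rw [prodSpan]
  congr 1
  ext F
  constructor
  · rintro ⟨s, ⟨hs, hsum⟩, rfl⟩
    exact ⟨⟨⟨s, fun {i} hi => Nat.pos_of_ne_zero fun h => hP s hs (h ▸ hi), hsum⟩, hs⟩, rfl⟩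
  · rintro ⟨lam, rfl⟩
    exact ⟨lam.1.parts, ⟨lam.2, lam.1.parts_sum⟩, rfl⟩

/-- A spanning family of `gammaHom n` of the right cardinality is linearly independent. -/
theorem linearIndependent_of_gammaHom_le {n : ℕ} {ι : Type*} [Fintype ι] {b : ι → Series}
    (hb : ∀ i, b i ∈ gammaHom n) (hcard : Fintype.card ι = (Nat.Partition.distincts n).card)
    (hspan : gammaHom n ≤ Submodule.span K (Set.range b)) : LinearIndependent K b := by
  let b' : ι → gammaHom n := fun i => ⟨b i, hb i⟩
  have hb' : b = (gammaHom n).subtype ∘ b' := rfl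
  have h : LinearIndependent K b' := by
    refine linearIndependent_of_top_le_span_of_card_eq_finrank ?_
      (hcard.trans (finrank_gammaHom n).symm)
    rintro ⟨g, hg⟩ -
    have h1 := hspan hg
    rw [hb', Set.range_comp, ← Submodule.map_span] at h1
    obtain ⟨y, hy, hyg⟩ := h1
    have : y = ⟨g, hg⟩ := Subtype.ext hyg
    exact this ▸ hy
  rw [hb']
  exact h.map' _ (Submodule.ker_subtype _)

/-- A family of products indexed by as many partitions of `n` as there are strict ones, whose
leading forms span the classical algebra in each degree, gives unique expansions. -/
theorem uniquelyExpands_of_gammaHom_le {S : Set Partitions} {P : Set (Multiset ℕ)}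
    (hS : ∀ lam : Partitions, lam ∈ S ↔ lam.2.parts ∈ P)
    (hP : ∀ s ∈ P, 0 ∉ s)
    (hcard : ∀ n, Nat.card {lam : n.Partition // lam.parts ∈ P} =
      (Nat.Partition.distincts n).card)
    {u B : ℕ → Series} (hu : ∀ s ∈ P, ∀ k ∈ s, u k ∈ gammaHat)
    (hlead : ∀ k, LeadingForm k (u k) (B k))
    (hspan : ∀ n, gammaHom n ≤ prodSpan B P n) {f : Series} (hf : f ∈ gammaHat) :
    UniquelyExpands S u f := by
  classical
  have hmem : ∀ lam : S, partProd u lam ∈ gammaHat := fun lam =>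
    partProd_mem_gammaHat (hu _ ((hS _).mp lam.2))
  have hform : ∀ lam : S, LeadingForm lam.1.1 (partProd u lam) (partProd B lam) := fun lam =>
    leadingForm_partProd fun k _ => hlead k
  let emb : (n : ℕ) → {lam : n.Partition // lam.parts ∈ P} ↪ S := fun n =>
    ⟨fun lam => ⟨⟨n, lam.1⟩, (hS _).mpr lam.2⟩, fun lam mu h => by
      have h1 := congrArg Subtype.val h
      exact Subtype.ext (eq_of_heq (Sigma.mk.inj h1).2)⟩
  let fib : ℕ → Finset S := fun n => Finset.univ.map (emb n)
  have hfib : ∀ n (lam : S), lam ∈ fib n ↔ lam.1.1 = n := by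
    rintro n ⟨⟨m, lam⟩, h⟩
    simp only [fib, Finset.mem_map, Finset.mem_univ, true_and]
    constructor
    · rintro ⟨mu, hmu⟩
      exact (congrArg (fun i : S => i.1.1) hmu).symm
    · rintro rfl
      exact ⟨⟨lam, (hS _).mp h⟩, rfl⟩
  have hindep : ∀ n, LinearIndependent K
      fun lam : {lam : n.Partition // lam.parts ∈ P} => partProd B (emb n lam) := fun n =>
    linearIndependent_of_gammaHom_le (fun lam => (hform (emb n lam)).mem_gammaHom (hmem _))
      (by rw [← Nat.card_eq_fintype_card, hcard])
      ((hspan n).trans (prodSpan_eq_span_range B hP n).le)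
  refine existsUnique_isFormalSum (deg := fun lam : S => lam.1.1) (fib := fib)
    (T := fun n => (Finset.range n).biUnion fib) hfib (fun n lam => ?_)
    (fun lam => (hform lam).coeff_of_lt) (G := Subalgebra.toSubmodule gammaHat) hmem
    (fun n g hg hord => ?_) (fun n c hc => ?_) hf
  · simp [hfib]
  · obtain ⟨g', hg'⟩ := LeadingForm.exists_of_order hord
    have h := hspan n (hg'.mem_gammaHom hg)
    rw [prodSpan_eq_span_range B hP, Submodule.mem_span_range_iff_exists_fun] at h
    obtain ⟨c, hc⟩ := h
    refine ⟨Function.extend (emb n) c 0, fun d hd => ?_⟩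
    rw [hg'.coeff_of_eq d hd, ← hc, Finset.sum_map, map_sum]
    refine Finset.sum_congr rfl fun lam _ => ?_
    rw [(emb n).injective.extend_apply, (hform (emb n lam)).coeff_of_eq d hd, map_smul, smul_eq_mul]
    rfl
  · have h0 : ∑ lam, c (emb n lam) • partProd B (emb n lam) = 0 := by
      ext d
      rw [map_sum, map_zero]
      by_cases hd : d.degree = n
      · rw [← hc d hd, Finset.sum_map]
        refine Finset.sum_congr rfl fun lam _ => ?_
        rw [(hform (emb n lam)).coeff_of_eq d hd, map_smul, smul_eq_mul]
      · refine Finset.sum_eq_zero fun lam _ => ?_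
        rw [map_smul, (hform (emb n lam)).coeff_of_ne d hd, smul_zero]
    have h1 := Fintype.linearIndependent_iff.mp (hindep n) _ h0
    intro lam hlam
    obtain ⟨mu, -, rfl⟩ := Finset.mem_map.mp hlam
    exact h1 mu

end KQ

end

theorem mainTheorem2 (f : KQ.Series) (hf : f ∈ KQ.GGammaSharp) :
    KQ.UniquelyExpands KQ.OP KQ.pBeta f ∧
    KQ.UniquelyExpands KQ.OP KQ.qBeta f ∧
    KQ.UniquelyExpands KQ.OP KQ.qBarBeta f ∧
    KQ.UniquelyExpands KQ.SP KQ.qBeta f ∧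
    KQ.UniquelyExpands KQ.SP KQ.qBarBeta f := by
  have hf' := KQ.mem_gammaHat_of_mem_GGammaSharp hf
  have hOP : ∀ lam : KQ.Partitions, lam ∈ KQ.OP ↔ lam.2.parts ∈ KQ.oddMultisets :=
    fun _ => Iff.rfl
  have hSP : ∀ lam : KQ.Partitions, lam ∈ KQ.SP ↔ lam.2.parts ∈ KQ.strictMultisets :=
    fun lam => ⟨fun h => ⟨h, fun h0 => lt_irrefl 0 (lam.2.parts_pos h0)⟩, fun h => h.1⟩
  have hodd : ∀ s ∈ KQ.oddMultisets, 0 ∉ s := fun s hs h0 => by simpa using hs 0 h0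
  have hbar : ∀ k, KQ.qBarBeta k ∈ KQ.gammaHat := fun k =>
    KQ.subst_barVars_mem_gammaHat (KQ.qBeta_mem_gammaHat k)
  exact ⟨KQ.uniquelyExpands_of_gammaHom_le hOP hodd KQ.card_oddMultisets_eq
      (fun s hs k hk => KQ.pBeta_mem_gammaHat (hs k hk)) KQ.leadingForm_pBeta
      KQ.gammaHom_le_prodSpan_psum hf',
    KQ.uniquelyExpands_of_gammaHom_le hOP hodd KQ.card_oddMultisets_eq
      (fun _ _ k _ => KQ.qBeta_mem_gammaHat k) KQ.leadingForm_qBeta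
      KQ.gammaHom_le_prodSpan_qLead_odd hf',
    KQ.uniquelyExpands_of_gammaHom_le hOP hodd KQ.card_oddMultisets_eq
      (fun _ _ k _ => hbar k) KQ.leadingForm_qBarBeta
      (fun n => (KQ.gammaHom_le_prodSpan_qLead_odd n).trans
        (KQ.prodSpan_le_prodSpan_neg_one_pow_smul _ _ n)) hf',
    KQ.uniquelyExpands_of_gammaHom_le hSP (fun _ hs => hs.2) KQ.card_strictMultisets_eq
      (fun _ _ k _ => KQ.qBeta_mem_gammaHat k) KQ.leadingForm_qBeta
      KQ.gammaHom_le_prodSpan_qLead_strict hf',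
    KQ.uniquelyExpands_of_gammaHom_le hSP (fun _ hs => hs.2) KQ.card_strictMultisets_eq
      (fun _ _ k _ => hbar k) KQ.leadingForm_qBarBeta
      (fun n => (KQ.gammaHom_le_prodSpan_qLead_strict n).trans
        (KQ.prodSpan_le_prodSpan_neg_one_pow_smul _ _ n)) hf'⟩
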